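/- Let $S^3=\{(\alpha,\beta)\in\mathbb{C}^2 : |\alpha|^2+|\beta|^2=1\}$, and let the group $\mu_3=\{\zeta\in\mathbb{C} : \zeta^3=1\}$ of cube roots of unity act on $S^3$ by $\zeta\cdot(\alpha,\beta)=(\zeta\alpha,\zeta\beta)$. Let $\phi\colon S^3\to S^3$ be a continuous map with $\phi(\zeta\cdot x)=\zeta\cdot\phi(x)$ for all $\zeta\in\mu_3$ and $x\in S^3$. Then the degree of $\phi$, that is, the unique integer $d$ such that the induced homomorphism $\phi_*\colon H_3(S^3;\mathbb{Z})\to H_3(S^3;\mathbb{Z})$ on singular homology is multiplication by $d$, satisfies $d\equiv 1\pmod 3$. -/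

import Mathlib

/-- The unit sphere `S³ = {(α, β) : |α|² + |β|² = 1}` in `ℂ²`, with its Euclidean norm. -/
abbrev ThreeSphere : Type :=
  Metric.sphere (0 : EuclideanSpace ℂ (Fin 2)) 1

/-- The standard action of the group `μ₃` of complex cube roots of unity on `S³`: the root `ζ`
sends `(α, β)` to `(ζ α, ζ β)`. -/
noncomputable instance ThreeSphere.instMulActionCubeRoots :
    MulAction (rootsOfUnity 3 ℂ) ThreeSphere where
  smul ζ x := ⟨((ζ : ℂˣ) : ℂ) • (x : EuclideanSpace ℂ (Fin 2)), by
    have h3 : ((ζ : ℂˣ) : ℂ) ^ 3 = 1 := (mem_rootsOfUnity' 3 (ζ : ℂˣ)).1 ζ.2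
    have hζ : ‖((ζ : ℂˣ) : ℂ)‖ = 1 := Complex.norm_eq_one_of_pow_eq_one h3 (by norm_num)
    have hx : ‖(x : EuclideanSpace ℂ (Fin 2))‖ = 1 := by simp
    rw [mem_sphere_zero_iff_norm, norm_smul, hζ, hx, one_mul]⟩
  one_smul x := Subtype.ext (one_smul ℂ (x : EuclideanSpace ℂ (Fin 2)))
  mul_smul ζ ξ x :=
    Subtype.ext (mul_smul ((ζ : ℂˣ) : ℂ) ((ξ : ℂˣ) : ℂ) (x : EuclideanSpace ℂ (Fin 2)))

theorem ThreeSphere.coe_smul (ζ : rootsOfUnity 3 ℂ) (x : ThreeSphere) :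
    ((ζ • x : ThreeSphere) : EuclideanSpace ℂ (Fin 2)) =
      ((ζ : ℂˣ) : ℂ) • (x : EuclideanSpace ℂ (Fin 2)) := rfl

/-- The third singular homology group functor `X ↦ H₃(X; ℤ)`. -/
noncomputable abbrev singularH3 : CategoryTheory.Functor TopCat.{0} (ModuleCat.{0} ℤ) :=
  (AlgebraicTopology.singularHomologyFunctor (ModuleCat.{0} ℤ) 3).obj (ModuleCat.of ℤ ℤ)

/-- The integer `d` is a degree of the continuous map `φ : S³ → S³`: the endomorphism that `φ`
induces on `H₃(S³; ℤ)` is multiplication by `d`. -/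
def IsMappingDegree (φ : C(ThreeSphere, ThreeSphere)) (d : ℤ) : Prop :=
  ∀ c : singularH3.obj (TopCat.of ThreeSphere), singularH3.map (TopCat.ofHom φ) c = d • c

/-! Identify `S³` with the unit quaternions `α + βj`. The generator of `μ₃` then acts as left
multiplication by the unit quaternion `ω`, so for equivariant `φ` the map `f(x) = x⁻¹ φ(x)` is
invariant: `(ωx)⁻¹(ωφ(x)) = x⁻¹φ(x)`. Since `φ` is the pointwise product of the identity and `f`,
and pointwise products add on `H₃` (`push_pmul_mem`), the degree of `φ` is `1 + deg f`. An invariant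
map factors through the lens space `S³/μ₃`, and the quotient map has degree 3, so `3 ∣ deg f`.

The last point is proved on chains, without forming the quotient (`exists_push_of_invariant`). Write
`N = 1 + ρ + ρ²` for the rotation `ρ`. The action on simplices is free, so invariant chains are
exactly the norms `N e`, and the kernel of `N` is the image of `1 - ρ`. As `ρ` is homotopic to the
identity, `ρz - z = ∂u` for the fundamental cycle `z`. The chain `Nu` is an invariant 4-cycle; once
it bounds an invariant chain, `z` can be altered by a boundary to become a norm `Nw`, and `f` sends
`Nw` to `3 f(w)`.

Two homological inputs remain: `H₃(S³)` is infinite cyclic (`infiniteCyclic_univ`), and invariant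
cycles of dimension at least 4 bound invariantly (`invariantlyBounds_univ`), which expresses that
the lens space has no homology above dimension 3. Both follow from Mayer-Vietoris arguments on open
covers, resting on subdivision and on the prism operator. Chains are indexed by the number of
vertices, so `Chain X 4` consists of 3-chains, and index 0 carries the augmentation. -/

/-! ### Boundaries of semisimplicial chains -/

namespace SingularChain

/-- Two linear maps on chains agree if they agree on generators. -/
theorem linearMap_eq_of_single {ι M : Type*} [AddCommGroup M] {f g : (ι →₀ ℤ) →ₗ[ℤ] M}
    (h : ∀ i, f (Finsupp.single i 1) = g (Finsupp.single i 1)) (c : ι →₀ ℤ) : f c = g c :=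
  DFunLike.congr_fun (Finsupp.lhom_ext' fun i => LinearMap.ext_ring (h i) : f = g) c

/-- The alternating sum of faces of a generator. -/
noncomputable def altFace {B : ℕ → Type*} (face : ∀ n, Fin (n + 1) → B (n + 1) → B n) (n : ℕ) :
    (B (n + 1) →₀ ℤ) →ₗ[ℤ] (B n →₀ ℤ) :=
  Finsupp.linearCombination ℤ fun σ =>
    ∑ i : Fin (n + 1), (-1 : ℤ) ^ (i : ℕ) • Finsupp.single (face n i σ) (1 : ℤ)

theorem altFace_single {B : ℕ → Type*} (face : ∀ n, Fin (n + 1) → B (n + 1) → B n) {n : ℕ}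
    (σ : B (n + 1)) (k : ℤ) :
    altFace face n (Finsupp.single σ k) =
      k • ∑ i : Fin (n + 1), (-1 : ℤ) ^ (i : ℕ) • Finsupp.single (face n i σ) (1 : ℤ) := by
  simp [altFace]

/-- The double sum is split according to whether the first deleted index is at most the second. The
face identity matches the pair `(j, i)` with `j ≤ i` to the pair `(i + 1, j)`, whose sign is
opposite. -/
theorem altFace_altFace {B : ℕ → Type*} (face : ∀ n, Fin (n + 1) → B (n + 1) → B n)
    (h : ∀ (n : ℕ) (i j : Fin (n + 1)) (σ : B (n + 2)), i ≤ j →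
      face n i (face (n + 1) j.succ σ) = face n j (face (n + 1) i.castSucc σ))
    {n : ℕ} (c : B (n + 2) →₀ ℤ) : altFace face n (altFace face (n + 1) c) = 0 := by
  refine linearMap_eq_of_single (f := altFace face n ∘ₗ altFace face (n + 1)) (g := 0)
    (fun σ => ?_) c
  simp only [LinearMap.comp_apply, LinearMap.zero_apply, altFace_single, map_sum,
    map_smul, Finset.smul_sum, smul_smul]
  rw [← Finset.sum_product', Finset.univ_product_univ]
  let S : Finset (Fin (n + 2) × Fin (n + 1)) := {p | (p.1 : ℕ) ≤ (p.2 : ℕ)}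
  rw [← Finset.sum_add_sum_compl S, add_eq_zero_iff_eq_neg, ← Finset.sum_neg_distrib]
  refine Finset.sum_bij
    (fun p hp => (p.2.succ, p.1.castLT
      (lt_of_le_of_lt (Finset.mem_filter.1 hp).2 p.2.is_lt))) ?_ ?_ ?_ ?_
  · rintro ⟨j, i⟩ hp
    simp only [S, Finset.mem_filter, Finset.compl_filter, Finset.mem_univ, true_and,
      Fin.val_succ, Fin.val_castLT] at hp ⊢
    omega
  · rintro ⟨j, i⟩ hp ⟨j', i'⟩ hp' h
    simp only [Prod.mk.injEq, Fin.succ_inj] at h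
    ext
    · simpa using congrArg Fin.val h.2
    · simp [h.1]
  · rintro ⟨j, i⟩ hp
    simp only [S, Finset.mem_filter, Finset.compl_filter, Finset.mem_univ, true_and,
      not_le] at hp
    refine ⟨(i.castSucc, j.pred (by rintro rfl; simp at hp)), ?_, ?_⟩
    · simp only [S, Finset.mem_filter, Finset.mem_univ, true_and, Fin.val_castSucc,
        Fin.val_pred]
      omega
    · simp
  · rintro ⟨j, i⟩ hp
    simp only [S, Finset.mem_filter, Finset.mem_univ, true_and] at hp
    have hj : j = (j.castLT (lt_of_le_of_lt hp i.is_lt)).castSucc := by simp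
    dsimp only
    rw [h n (j.castLT (lt_of_le_of_lt hp i.is_lt)) i σ (by simpa [Fin.le_def] using hp),
      ← hj, ← neg_smul]
    congr 1
    simp only [Fin.val_succ, Fin.val_castLT, pow_succ]
    ring

theorem altFace_mapDomain {B B' : ℕ → Type*} (face : ∀ n, Fin (n + 1) → B (n + 1) → B n)
    (face' : ∀ n, Fin (n + 1) → B' (n + 1) → B' n) (f : ∀ n, B n → B' n) {n : ℕ}
    (h : ∀ (i : Fin (n + 1)) (σ : B (n + 1)), face' n i (f (n + 1) σ) = f n (face n i σ))
    (c : B (n + 1) →₀ ℤ) :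
    altFace face' n (Finsupp.mapDomain (f (n + 1)) c) =
      Finsupp.mapDomain (f n) (altFace face n c) := by
  induction c using Finsupp.induction_linear with
  | zero => simp
  | add a b ha hb => simp only [Finsupp.mapDomain_add, map_add, ha, hb]
  | single σ k =>
    simp only [Finsupp.mapDomain_single, altFace_single, h, Finsupp.mapDomain_smul,
      Finsupp.mapDomain_finsetSum]

theorem succAbove_succ_comp {n : ℕ} {i j : Fin (n + 1)} (h : i ≤ j) :
    j.succ.succAbove ∘ i.succAbove = i.castSucc.succAbove ∘ j.succAbove := by
  funext k
  simp only [Function.comp_apply, Fin.succAbove, Fin.ext_iff, Fin.lt_def, Fin.le_def] at h ⊢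
  split_ifs <;> simp_all <;> omega

/-! ### Chains of tuples of points -/

/-- Chains on tuples of `n` points of `S`, thought of as affine simplices. -/
abbrev TupleChain (S : Type*) (n : ℕ) := (Fin n → S) →₀ ℤ

section Tuple

variable {S S' : Type*}

/-- The boundary of a chain of tuples. -/
noncomputable def tupleBdry (S : Type*) (n : ℕ) : TupleChain S (n + 1) →ₗ[ℤ] TupleChain S n :=
  altFace (B := fun n => Fin n → S) (fun _ i v => v ∘ i.succAbove) n

theorem tupleBdry_single {n : ℕ} (v : Fin (n + 1) → S) (k : ℤ) :
    tupleBdry S n (Finsupp.single v k) =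
      k • ∑ i : Fin (n + 1), (-1 : ℤ) ^ (i : ℕ) • Finsupp.single (v ∘ i.succAbove) (1 : ℤ) :=
  altFace_single (B := fun n => Fin n → S) (fun _ i v => v ∘ i.succAbove) v k

theorem tupleBdry_tupleBdry {n : ℕ} (c : TupleChain S (n + 2)) :
    tupleBdry S n (tupleBdry S (n + 1) c) = 0 :=
  altFace_altFace (B := fun n => Fin n → S) (fun _ i v => v ∘ i.succAbove)
    (fun n i j σ h => by simp only [Function.comp_assoc, succAbove_succ_comp h]) c

/-- The map on chains of tuples induced by a map of points. -/
noncomputable def tupleMap (f : S → S') (n : ℕ) : TupleChain S n →ₗ[ℤ] TupleChain S' n :=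
  Finsupp.lmapDomain ℤ ℤ (f ∘ ·)

@[simp]
theorem tupleMap_single (f : S → S') {n : ℕ} (v : Fin n → S) (k : ℤ) :
    tupleMap f n (Finsupp.single v k) = Finsupp.single (f ∘ v) k := by
  simp [tupleMap]

theorem tupleBdry_tupleMap (f : S → S') {n : ℕ} (c : TupleChain S (n + 1)) :
    tupleBdry S' n (tupleMap f (n + 1) c) = tupleMap f n (tupleBdry S n c) :=
  altFace_mapDomain (B := fun n => Fin n → S) (B' := fun n => Fin n → S')
    (fun _ i v => v ∘ i.succAbove) (fun _ i v => v ∘ i.succAbove) (fun _ v => f ∘ v)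
    (fun _ _ => rfl) c

/-- The cone with apex `b`. -/
noncomputable def tupleCone (b : S) (n : ℕ) : TupleChain S n →ₗ[ℤ] TupleChain S (n + 1) :=
  Finsupp.lmapDomain ℤ ℤ fun v => (Fin.cons b v : Fin (n + 1) → S)

@[simp]
theorem tupleCone_single (b : S) {n : ℕ} (v : Fin n → S) (k : ℤ) :
    tupleCone b n (Finsupp.single v k) = Finsupp.single (Fin.cons b v : Fin (n + 1) → S) k := by
  simp [tupleCone]

theorem tupleMap_tupleCone (f : S → S') (b : S) {n : ℕ} (c : TupleChain S n) :
    tupleMap f (n + 1) (tupleCone b n c) = tupleCone (f b) n (tupleMap f n c) := by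
  induction c using Finsupp.induction_linear with
  | zero => simp
  | add a b ha hb => simp only [map_add, ha, hb]
  | single v k =>
    simp only [tupleCone_single, tupleMap_single]
    congr 1
    funext i
    refine Fin.cases ?_ (fun i => ?_) i <;> simp

theorem tupleBdry_tupleCone_zero (b : S) (c : TupleChain S 0) :
    tupleBdry S 0 (tupleCone b 0 c) = c := by
  induction c using Finsupp.induction_linear with
  | zero => simp
  | add a b ha hb => simp only [map_add, ha, hb]
  | single v k =>
    rw [tupleCone_single, tupleBdry_single]
    simp [Subsingleton.elim _ v]

/-- Deleting the apex returns the base, and deleting any other vertex gives the cone over a face of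
the base with the index, hence the sign, shifted by one. -/
theorem tupleBdry_tupleCone (b : S) {n : ℕ} (c : TupleChain S (n + 1)) :
    tupleBdry S (n + 1) (tupleCone b (n + 1) c) = c - tupleCone b n (tupleBdry S n c) := by
  induction c using Finsupp.induction_linear with
  | zero => simp
  | add a b ha hb => simp only [map_add, ha, hb]; abel
  | single v k =>
    rw [tupleCone_single, tupleBdry_single, tupleBdry_single, Fin.sum_univ_succ]
    have h0 : (Fin.cons b v : Fin (n + 2) → S) ∘ Fin.succAbove 0 = v := by
      funext i; simp
    have h1 (i : Fin (n + 1)) : (Fin.cons b v : Fin (n + 2) → S) ∘ Fin.succAbove i.succ =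
        Fin.cons b (v ∘ i.succAbove) := by
      funext j; refine Fin.cases ?_ (fun j => ?_) j <;> simp
    simp only [h0, h1, Fin.val_succ, pow_succ, map_smul, map_sum, tupleCone_single]
    simp [smul_add, sub_eq_add_neg]

/-- Subdivision of chains of tuples, given a choice `b` of an interior point of each tuple. -/
noncomputable def tupleSd (b : ∀ n, (Fin (n + 1) → S) → S) :
    ∀ n, TupleChain S n →ₗ[ℤ] TupleChain S n
  | 0 => LinearMap.id
  | n + 1 => Finsupp.linearCombination ℤ fun v =>
      tupleCone (b n v) n (tupleSd b n (tupleBdry S n (Finsupp.single v 1)))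

theorem tupleSd_single (b : ∀ n, (Fin (n + 1) → S) → S) {n : ℕ} (v : Fin (n + 1) → S) :
    tupleSd b (n + 1) (Finsupp.single v 1) =
      tupleCone (b n v) n (tupleSd b n (tupleBdry S n (Finsupp.single v 1))) := by
  simp [tupleSd]

/-- By induction the subdivided boundary of a tuple is itself a cycle, so the cone formula leaves
only the base of the cone. -/
theorem tupleBdry_tupleSd (b : ∀ n, (Fin (n + 1) → S) → S) {n : ℕ} (c : TupleChain S (n + 1)) :
    tupleBdry S n (tupleSd b (n + 1) c) = tupleSd b n (tupleBdry S n c) := by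
  induction n with
  | zero =>
    refine linearMap_eq_of_single
      (f := tupleBdry S 0 ∘ₗ tupleSd b 1) (g := tupleSd b 0 ∘ₗ tupleBdry S 0) (fun v => ?_) c
    simp only [LinearMap.comp_apply, tupleSd_single, tupleBdry_tupleCone_zero]
  | succ n ih =>
    refine linearMap_eq_of_single (f := tupleBdry S (n + 1) ∘ₗ tupleSd b (n + 2))
      (g := tupleSd b (n + 1) ∘ₗ tupleBdry S (n + 1)) (fun v => ?_) c
    simp only [LinearMap.comp_apply, tupleSd_single, tupleBdry_tupleCone, ih,
      tupleBdry_tupleBdry, map_zero, sub_zero]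

theorem tupleMap_tupleSd (b : ∀ n, (Fin (n + 1) → S) → S) (b' : ∀ n, (Fin (n + 1) → S') → S')
    (f : S → S') (hf : ∀ n v, f (b n v) = b' n (f ∘ v)) {n : ℕ} (c : TupleChain S n) :
    tupleMap f n (tupleSd b n c) = tupleSd b' n (tupleMap f n c) := by
  induction n with
  | zero => rfl
  | succ n ih =>
    refine linearMap_eq_of_single (f := tupleMap f (n + 1) ∘ₗ tupleSd b (n + 1))
      (g := tupleSd b' (n + 1) ∘ₗ tupleMap f (n + 1)) (fun v => ?_) c
    simp only [LinearMap.comp_apply, tupleSd_single, tupleMap_tupleCone, ih, hf,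
      tupleMap_single, ← tupleBdry_tupleMap]

/-- The homotopy between two augmented chain maps obtained by coning off. -/
noncomputable def tupleHtpy (F G : ∀ n, TupleChain S n →ₗ[ℤ] TupleChain S' n)
    (b : ∀ n, (Fin (n + 1) → S) → S') : ∀ n, TupleChain S n →ₗ[ℤ] TupleChain S' (n + 1)
  | 0 => 0
  | n + 1 => Finsupp.linearCombination ℤ fun v => tupleCone (b n v) (n + 1)
      (G (n + 1) (Finsupp.single v 1) - F (n + 1) (Finsupp.single v 1) -
        tupleHtpy F G b n (tupleBdry S n (Finsupp.single v 1)))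

variable {F G : ∀ n, TupleChain S n →ₗ[ℤ] TupleChain S' n} {b : ∀ n, (Fin (n + 1) → S) → S'}

theorem tupleHtpy_single {n : ℕ} (v : Fin (n + 1) → S) :
    tupleHtpy F G b (n + 1) (Finsupp.single v 1) = tupleCone (b n v) (n + 1)
      (G (n + 1) (Finsupp.single v 1) - F (n + 1) (Finsupp.single v 1) -
        tupleHtpy F G b n (tupleBdry S n (Finsupp.single v 1))) := by
  simp [tupleHtpy]

/-- The chain that gets coned off is a cycle by induction, so its cone bounds it exactly. Agreement
of `F` and `G` on the empty tuple starts the induction. This one construction yields both the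
subdivision homotopy and the prism. -/
theorem tupleBdry_tupleHtpy (h0 : F 0 = G 0)
    (hF : ∀ n c, tupleBdry S' n (F (n + 1) c) = F n (tupleBdry S n c))
    (hG : ∀ n c, tupleBdry S' n (G (n + 1) c) = G n (tupleBdry S n c)) {n : ℕ}
    (c : TupleChain S (n + 1)) :
    tupleBdry S' (n + 1) (tupleHtpy F G b (n + 1) c) =
      G (n + 1) c - F (n + 1) c - tupleHtpy F G b n (tupleBdry S n c) := by
  induction n with
  | zero =>
    refine linearMap_eq_of_single (f := tupleBdry S' 1 ∘ₗ tupleHtpy F G b 1)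
      (g := G 1 - F 1 - tupleHtpy F G b 0 ∘ₗ tupleBdry S 0) (fun v => ?_) c
    simp only [LinearMap.comp_apply, tupleHtpy_single, tupleBdry_tupleCone, LinearMap.sub_apply,
      map_sub, hF, hG, h0]
    simp [tupleHtpy]
  | succ n ih =>
    refine linearMap_eq_of_single (f := tupleBdry S' (n + 2) ∘ₗ tupleHtpy F G b (n + 2))
      (g := G (n + 2) - F (n + 2) - tupleHtpy F G b (n + 1) ∘ₗ tupleBdry S (n + 1))
      (fun v => ?_) c
    simp only [LinearMap.comp_apply, tupleHtpy_single, tupleBdry_tupleCone, LinearMap.sub_apply,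
      map_sub, hF, hG, ih, tupleBdry_tupleBdry, map_zero]
    abel

theorem tupleMap_tupleHtpy {R R' : Type*} {F₂ G₂ : ∀ n, TupleChain R n →ₗ[ℤ] TupleChain R' n}
    {b₂ : ∀ n, (Fin (n + 1) → R) → R'} (f : S → R) (f' : S' → R')
    (hF : ∀ n c, tupleMap f' n (F n c) = F₂ n (tupleMap f n c))
    (hG : ∀ n c, tupleMap f' n (G n c) = G₂ n (tupleMap f n c))
    (hb : ∀ n v, f' (b n v) = b₂ n (f ∘ v)) {n : ℕ} (c : TupleChain S n) :
    tupleMap f' (n + 1) (tupleHtpy F G b n c) = tupleHtpy F₂ G₂ b₂ n (tupleMap f n c) := by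
  induction n with
  | zero => simp [tupleHtpy]
  | succ n ih =>
    refine linearMap_eq_of_single (f := tupleMap f' (n + 2) ∘ₗ tupleHtpy F G b (n + 1))
      (g := tupleHtpy F₂ G₂ b₂ (n + 1) ∘ₗ tupleMap f (n + 1)) (fun v => ?_) c
    simp only [LinearMap.comp_apply, tupleMap_single, tupleHtpy_single, tupleMap_tupleCone,
      map_sub, ih, hF, hG, hb, ← tupleBdry_tupleMap]

end Tuple

end SingularChain

namespace SingularChain

/-! ### Singular chains, augmented by the empty simplex -/

/-- The standard simplex with `n` vertices. -/
abbrev Splx (n : ℕ) : Type := stdSimplex ℝ (Fin n)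

/-- The affine map of standard simplices induced by a map of vertices. -/
noncomputable def splxMap {m n : ℕ} (f : Fin m → Fin n) : C(Splx m, Splx n) :=
  ⟨stdSimplex.map f, stdSimplex.continuous_map f⟩

/-- Singular chains on simplices with `n` vertices; for `n = 0` there is one empty simplex. -/
abbrev Chain (X : Type*) [TopologicalSpace X] (n : ℕ) := C(Splx n, X) →₀ ℤ

variable {X Y Z : Type*} [TopologicalSpace X] [TopologicalSpace Y] [TopologicalSpace Z]

/-- The boundary of a singular chain. -/
noncomputable def bdry (X : Type*) [TopologicalSpace X] (n : ℕ) :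
    Chain X (n + 1) →ₗ[ℤ] Chain X n :=
  altFace (B := fun n => C(Splx n, X)) (fun _ i σ => σ.comp (splxMap i.succAbove)) n

theorem bdry_single {n : ℕ} (σ : C(Splx (n + 1), X)) (k : ℤ) :
    bdry X n (Finsupp.single σ k) = k • ∑ i : Fin (n + 1), (-1 : ℤ) ^ (i : ℕ) •
      Finsupp.single (σ.comp (splxMap i.succAbove)) (1 : ℤ) :=
  altFace_single (B := fun n => C(Splx n, X)) (fun _ i σ => σ.comp (splxMap i.succAbove)) σ k

theorem splxMap_comp {l m n : ℕ} (g : Fin m → Fin n) (f : Fin l → Fin m) :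
    (splxMap g).comp (splxMap f) = splxMap (g ∘ f) := by
  ext1 x
  exact stdSimplex.map_comp_apply f g x

theorem bdry_bdry {n : ℕ} (c : Chain X (n + 2)) : bdry X n (bdry X (n + 1) c) = 0 :=
  altFace_altFace (B := fun n => C(Splx n, X)) (fun _ i σ => σ.comp (splxMap i.succAbove))
    (fun n i j σ h => by
      simp only [ContinuousMap.comp_assoc, splxMap_comp, succAbove_succ_comp h]) c

/-- The map of singular chains induced by a continuous map. -/
noncomputable def push (f : C(X, Y)) (n : ℕ) : Chain X n →ₗ[ℤ] Chain Y n :=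
  Finsupp.lmapDomain ℤ ℤ f.comp

@[simp]
theorem push_single (f : C(X, Y)) {n : ℕ} (σ : C(Splx n, X)) (k : ℤ) :
    push f n (Finsupp.single σ k) = Finsupp.single (f.comp σ) k := by
  simp [push]

theorem bdry_push (f : C(X, Y)) {n : ℕ} (c : Chain X (n + 1)) :
    bdry Y n (push f (n + 1) c) = push f n (bdry X n c) :=
  altFace_mapDomain (B := fun n => C(Splx n, X)) (B' := fun n => C(Splx n, Y))
    (fun _ i σ => σ.comp (splxMap i.succAbove)) (fun _ i σ => σ.comp (splxMap i.succAbove))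
    (fun _ σ => f.comp σ) (fun _ _ => rfl) c

theorem push_push (g : C(Y, Z)) (f : C(X, Y)) {n : ℕ} (c : Chain X n) :
    push g n (push f n c) = push (g.comp f) n c :=
  linearMap_eq_of_single (f := push g n ∘ₗ push f n) (g := push (g.comp f) n)
    (fun σ => by simp [ContinuousMap.comp_assoc]) c

@[simp]
theorem push_id {n : ℕ} (c : Chain X n) : push (ContinuousMap.id X) n c = c :=
  linearMap_eq_of_single (f := push (ContinuousMap.id X) n) (g := LinearMap.id)
    (fun σ => by simp) c

/-! ### Spaces with barycentric combinations -/

/-- A topological space in which tuples of points span affine simplices. -/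
class BarycentricSpace (S : Type*) [TopologicalSpace S] where
  /-- The affine simplex spanned by a tuple of points. -/
  comb : ∀ {n : ℕ}, (Fin n → S) → C(Splx n, S)
  comb_comp : ∀ {m n : ℕ} (v : Fin n → S) (f : Fin m → Fin n),
    comb (v ∘ f) = (comb v).comp (splxMap f)

open BarycentricSpace

theorem sum_splxMap_smul {E : Type*} [AddCommGroup E] [Module ℝ E] {m n : ℕ} (f : Fin m → Fin n)
    (t : Splx m) (v : Fin n → E) :
    ∑ j, (splxMap f t) j • v j = ∑ i, t i • v (f i) := by
  simp only [splxMap, ContinuousMap.coe_mk, stdSimplex.map_coe,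
    FunOnFinite.linearMap_apply_apply, Finset.sum_smul]
  rw [← Finset.sum_fiberwise Finset.univ f]
  refine Finset.sum_congr rfl fun j _ => Finset.sum_congr rfl fun i hi => ?_
  rw [(Finset.mem_filter.1 hi).2]

/-- A convex set has barycentric combinations. -/
@[reducible]
noncomputable def BarycentricSpace.ofConvex {E : Type*} [NormedAddCommGroup E] [NormedSpace ℝ E]
    {S : Set E} (hS : Convex ℝ S) : BarycentricSpace S where
  comb v := ⟨fun t => ⟨∑ i, t i • (v i : E),
    hS.sum_mem (fun i _ => t.2.1 i) t.2.2 fun i _ => (v i).2⟩, by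
      refine Continuous.subtype_mk (continuous_finsetSum _ fun i _ => ?_) _
      exact ((continuous_apply i).comp continuous_subtype_val).smul continuous_const⟩
  comb_comp v f := by
    ext t
    exact (sum_splxMap_smul f t fun j => (v j : E)).symm

noncomputable instance (n : ℕ) : BarycentricSpace (Splx n) :=
  .ofConvex (convex_stdSimplex ℝ (Fin n))

noncomputable instance : BarycentricSpace unitInterval :=
  .ofConvex (convex_Icc (0 : ℝ) 1)

noncomputable instance {S T : Type*} [TopologicalSpace S] [TopologicalSpace T]
    [BarycentricSpace S] [BarycentricSpace T] : BarycentricSpace (S × T) where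
  comb v := (comb fun i => (v i).1).prodMk (comb fun i => (v i).2)
  comb_comp v f := by
    ext t
    · exact DFunLike.congr_fun (comb_comp (fun i => (v i).1) f) t
    · exact DFunLike.congr_fun (comb_comp (fun i => (v i).2) f) t

variable {S T : Type*} [TopologicalSpace S] [TopologicalSpace T]
  [BarycentricSpace S] [BarycentricSpace T]

/-- A continuous map that preserves barycentric combinations. -/
def PreservesComb (f : C(S, T)) : Prop :=
  ∀ (n : ℕ) (v : Fin n → S), f.comp (comb v) = comb (f ∘ v)

theorem preservesComb_splxMap {m n : ℕ} (f : Fin m → Fin n) : PreservesComb (splxMap f) := by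
  intro k v
  ext t j
  change FunOnFinite.linearMap ℝ ℝ f (∑ i, t i • ((v i : Splx m) : Fin m → ℝ)) j =
    (∑ i, t i • ((splxMap f (v i) : Splx n) : Fin n → ℝ)) j
  rw [map_sum]
  simp only [map_smul]
  rfl

theorem PreservesComb.prodMap_id {f : C(S, T)} (hf : PreservesComb f) (U : Type*)
    [TopologicalSpace U] [BarycentricSpace U] :
    PreservesComb (f.prodMap (ContinuousMap.id U)) := by
  intro n v
  ext t
  · exact DFunLike.congr_fun (hf _ fun i => (v i).1) t
  · rfl

/-- The centroid of a nonempty tuple. -/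
noncomputable def centroid (n : ℕ) (v : Fin (n + 1) → S) : S :=
  comb v stdSimplex.barycenter

theorem PreservesComb.map_centroid {f : C(S, T)} (hf : PreservesComb f) (n : ℕ)
    (v : Fin (n + 1) → S) : f (centroid n v) = centroid n (f ∘ v) :=
  DFunLike.congr_fun (hf _ v) _

/-- The singular chain defined by a chain of tuples. -/
noncomputable def realize (S : Type*) [TopologicalSpace S] [BarycentricSpace S] (n : ℕ) :
    TupleChain S n →ₗ[ℤ] Chain S n :=
  Finsupp.lmapDomain ℤ ℤ comb

@[simp]
theorem realize_single {n : ℕ} (v : Fin n → S) (k : ℤ) :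
    realize S n (Finsupp.single v k) = Finsupp.single (comb v) k := by
  simp [realize]

theorem bdry_realize {n : ℕ} (c : TupleChain S (n + 1)) :
    bdry S n (realize S (n + 1) c) = realize S n (tupleBdry S n c) :=
  altFace_mapDomain (B := fun n => Fin n → S) (B' := fun n => C(Splx n, S))
    (fun _ i v => v ∘ i.succAbove) (fun _ i σ => σ.comp (splxMap i.succAbove))
    (fun _ v => comb v) (fun i v => (comb_comp v i.succAbove).symm) c

theorem PreservesComb.push_realize {f : C(S, T)} (hf : PreservesComb f) {n : ℕ}
    (c : TupleChain S n) : push f n (realize S n c) = realize T n (tupleMap f n c) :=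
  linearMap_eq_of_single (f := push f n ∘ₗ realize S n) (g := realize T n ∘ₗ tupleMap f n)
    (fun v => by simp [hf _ v]) c

/-- The tuple of all vertices of a standard simplex. -/
noncomputable def verts (n : ℕ) : Fin n → Splx n := fun i => stdSimplex.vertex i

theorem comb_verts (n : ℕ) : comb (verts n) = ContinuousMap.id (Splx n) := by
  ext t j
  change (∑ i, t i • (Pi.single i (1 : ℝ) : Fin n → ℝ)) j = t j
  simp [Finset.sum_apply, Pi.single_apply]

theorem splxMap_verts {m n : ℕ} (f : Fin m → Fin n) : splxMap f ∘ verts m = verts n ∘ f := by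
  funext i
  exact stdSimplex.map_vertex f i

/-! ### Natural operators on singular chains -/

/-- The operator on singular chains that sends `σ` to the image under `Φ σ` of a fixed chain of
tuples. -/
noncomputable def tupleOp {n m : ℕ} (Φ : C(Splx n, X) → C(S, Y)) (u : TupleChain S m) :
    Chain X n →ₗ[ℤ] Chain Y m :=
  Finsupp.linearCombination ℤ fun σ => push (Φ σ) m (realize S m u)

@[simp]
theorem tupleOp_single {n m : ℕ} (Φ : C(Splx n, X) → C(S, Y)) (u : TupleChain S m)
    (σ : C(Splx n, X)) (k : ℤ) :
    tupleOp Φ u (Finsupp.single σ k) = k • push (Φ σ) m (realize S m u) := by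
  simp [tupleOp]

theorem bdry_tupleOp {n m : ℕ} (Φ : C(Splx n, X) → C(S, Y)) (u : TupleChain S (m + 1))
    (c : Chain X n) : bdry Y m (tupleOp Φ u c) = tupleOp Φ (tupleBdry S m u) c :=
  linearMap_eq_of_single (f := bdry Y m ∘ₗ tupleOp Φ u) (g := tupleOp Φ (tupleBdry S m u))
    (fun σ => by simp [bdry_push, bdry_realize]) c

/-- A face of `σ` is `σ` precomposed with a coface, so the alternating sum can be moved from the
singular simplices to the model chain `u`. With this, identities between natural operators reduce to
identities between chains of tuples. -/
theorem tupleOp_bdry {n m : ℕ} (Φ : C(Splx n, X) → C(S, Y)) (Φ' : C(Splx (n + 1), X) → C(T, Y))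
    (δ : Fin (n + 1) → C(S, T)) (hδ : ∀ i, PreservesComb (δ i))
    (hΦ : ∀ σ i, Φ (σ.comp (splxMap i.succAbove)) = (Φ' σ).comp (δ i)) (u : TupleChain S m)
    (c : Chain X (n + 1)) :
    tupleOp Φ u (bdry X n c) =
      tupleOp Φ' (∑ i : Fin (n + 1), (-1 : ℤ) ^ (i : ℕ) • tupleMap (δ i) m u) c := by
  refine linearMap_eq_of_single (f := tupleOp Φ u ∘ₗ bdry X n) (g := tupleOp Φ' _)
    (fun σ => ?_) c
  simp only [LinearMap.comp_apply, bdry_single, map_smul, map_sum, tupleOp_single, one_smul, hΦ,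
    ← push_push, (hδ _).push_realize]

theorem push_tupleOp {W : Type*} [TopologicalSpace W] {n m : ℕ} (Φ : C(Splx n, X) → C(S, Y))
    (Φ' : C(Splx n, Z) → C(S, W)) (f : C(X, Z)) (g : C(Y, W))
    (h : ∀ σ, g.comp (Φ σ) = Φ' (f.comp σ)) (u : TupleChain S m) (c : Chain X n) :
    push g m (tupleOp Φ u c) = tupleOp Φ' u (push f n c) :=
  linearMap_eq_of_single (f := push g m ∘ₗ tupleOp Φ u) (g := tupleOp Φ' u ∘ₗ push f n)
    (fun σ => by simp [push_push, h]) c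

theorem tupleOp_sub {n m : ℕ} (Φ : C(Splx n, X) → C(S, Y)) (u u' : TupleChain S m)
    (c : Chain X n) : tupleOp Φ (u - u') c = tupleOp Φ u c - tupleOp Φ u' c :=
  linearMap_eq_of_single (f := tupleOp Φ (u - u')) (g := tupleOp Φ u - tupleOp Φ u')
    (fun σ => by simp) c

/-- The chain of the identity tuple of a standard simplex. -/
noncomputable abbrev vertsChain (n : ℕ) : TupleChain (Splx n) n := Finsupp.single (verts n) 1

/-- Rewrites the sum produced by `tupleOp_bdry`: when `L` and `L'` are compatible with the cofaces,
it is `L'` of the boundary of the universal simplex. -/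
theorem sum_tupleMap_vertsChain {R R' : Type*} {n m : ℕ}
    (L : TupleChain (Splx n) n →ₗ[ℤ] TupleChain R m)
    (L' : TupleChain (Splx (n + 1)) n →ₗ[ℤ] TupleChain R' m) (δ : Fin (n + 1) → R → R')
    (h : ∀ i c, tupleMap (δ i) m (L c) = L' (tupleMap (splxMap i.succAbove) n c)) :
    ∑ i : Fin (n + 1), (-1 : ℤ) ^ (i : ℕ) • tupleMap (δ i) m (L (vertsChain n)) =
      L' (tupleBdry _ n (vertsChain (n + 1))) := by
  rw [tupleBdry_single, one_smul, map_sum]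
  refine Finset.sum_congr rfl fun i _ => ?_
  rw [h, map_smul, tupleMap_single, splxMap_verts]

/-! ### Subdivision -/

/-- The subdivision of singular chains. -/
noncomputable def sd (X : Type*) [TopologicalSpace X] (n : ℕ) : Chain X n →ₗ[ℤ] Chain X n :=
  tupleOp (fun σ => σ) (tupleSd centroid n (vertsChain n))

/-- The homotopy between the identity and the subdivision of chains of tuples. -/
noncomputable def tupleSdHtpy (S : Type*) [TopologicalSpace S] [BarycentricSpace S] (n : ℕ) :
    TupleChain S n →ₗ[ℤ] TupleChain S (n + 1) :=
  tupleHtpy (fun _ => LinearMap.id) (tupleSd centroid) centroid n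

theorem tupleBdry_tupleSdHtpy {n : ℕ} (c : TupleChain S (n + 1)) :
    tupleBdry _ (n + 1) (tupleSdHtpy S (n + 1) c) =
      tupleSd centroid (n + 1) c - c - tupleSdHtpy S n (tupleBdry S n c) :=
  tupleBdry_tupleHtpy (F := fun _ => LinearMap.id) rfl (fun _ _ => rfl)
    (fun _ c => tupleBdry_tupleSd _ c) c

theorem PreservesComb.tupleMap_tupleSd {f : C(S, T)} (hf : PreservesComb f) {n : ℕ}
    (c : TupleChain S n) :
    tupleMap f n (tupleSd centroid n c) = tupleSd centroid n (tupleMap f n c) :=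
  SingularChain.tupleMap_tupleSd centroid centroid f hf.map_centroid c

theorem PreservesComb.tupleMap_tupleSdHtpy {f : C(S, T)} (hf : PreservesComb f) {n : ℕ}
    (c : TupleChain S n) :
    tupleMap f (n + 1) (tupleSdHtpy S n c) = tupleSdHtpy T n (tupleMap f n c) :=
  tupleMap_tupleHtpy (F := fun _ => LinearMap.id) (F₂ := fun _ => LinearMap.id) f f
    (fun _ _ => rfl) (fun _ c => hf.tupleMap_tupleSd c) hf.map_centroid c

/-- The homotopy between the identity and the subdivision of singular chains. -/
noncomputable def sdHtpy (X : Type*) [TopologicalSpace X] (n : ℕ) :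
    Chain X n →ₗ[ℤ] Chain X (n + 1) :=
  tupleOp (fun σ => σ) (tupleSdHtpy _ n (vertsChain n))

theorem tupleOp_vertsChain {n : ℕ} (c : Chain X n) :
    tupleOp (fun σ => σ) (vertsChain n) c = c :=
  linearMap_eq_of_single (f := tupleOp (fun σ => σ) (vertsChain n)) (g := LinearMap.id)
    (fun σ => by simp [comb_verts]) c

theorem sd_bdry {n : ℕ} (c : Chain X (n + 1)) :
    sd X n (bdry X n c) = bdry X n (sd X (n + 1) c) := by
  rw [sd, sd, bdry_tupleOp, tupleBdry_tupleSd, tupleOp_bdry _ (fun σ => σ)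
    (fun i => splxMap i.succAbove) (fun i => preservesComb_splxMap _) (fun _ _ => rfl)]
  rw [sum_tupleMap_vertsChain (tupleSd centroid n) (tupleSd centroid n) _ fun i =>
    (preservesComb_splxMap _).tupleMap_tupleSd]

theorem bdry_sdHtpy {n : ℕ} (c : Chain X (n + 1)) :
    bdry X (n + 1) (sdHtpy X (n + 1) c) = sd X (n + 1) c - c - sdHtpy X n (bdry X n c) := by
  rw [sdHtpy, sdHtpy, bdry_tupleOp, tupleBdry_tupleSdHtpy, tupleOp_bdry _ (fun σ => σ)
    (fun i => splxMap i.succAbove) (fun i => preservesComb_splxMap _) (fun _ _ => rfl),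
    sum_tupleMap_vertsChain (tupleSdHtpy _ n) (tupleSdHtpy _ n) _ fun i =>
      (preservesComb_splxMap _).tupleMap_tupleSdHtpy,
    tupleOp_sub, tupleOp_sub, tupleOp_vertsChain, sd]

theorem push_sd (f : C(X, Y)) {n : ℕ} (c : Chain X n) :
    push f n (sd X n c) = sd Y n (push f n c) :=
  push_tupleOp (fun σ => σ) (fun σ => σ) f f (fun _ => rfl) _ c

theorem push_sdHtpy (f : C(X, Y)) {n : ℕ} (c : Chain X n) :
    push f (n + 1) (sdHtpy X n c) = sdHtpy Y n (push f n c) :=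
  push_tupleOp (fun σ => σ) (fun σ => σ) f f (fun _ => rfl) _ c

/-! ### The prism operator -/

/-- The inclusion of `X` into the cylinder at a given height. -/
def atHeight (X : Type*) [TopologicalSpace X] (s : unitInterval) : C(X, X × unitInterval) :=
  (ContinuousMap.id X).prodMk (ContinuousMap.const X s)

theorem preservesComb_atHeight (s : unitInterval) : PreservesComb (atHeight S s) := by
  intro n v
  ext t
  · rfl
  · change (s : ℝ) = ∑ i, t i • (s : ℝ)
    rw [← Finset.sum_smul, stdSimplex.sum_eq_one, one_smul]

theorem tupleOp_atHeight (s : unitInterval) {n : ℕ} (c : Chain X n) :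
    tupleOp (fun σ : C(Splx n, X) => σ.prodMap (ContinuousMap.id unitInterval))
      (tupleMap (fun x => (x, s)) n (vertsChain n)) c = push (atHeight X s) n c := by
  refine linearMap_eq_of_single (f := tupleOp _ _) (g := push (atHeight X s) n) (fun σ => ?_) c
  have := (preservesComb_atHeight (S := Splx n) s).push_realize (vertsChain n)
  rw [tupleOp_single, one_smul]
  -- The goal contains the bare function `x ↦ (x, s)` and `this` the coercion of `atHeight`; the two
  -- agree only after unfolding.
  erw [← this]
  rw [realize_single, comb_verts, push_push, push_single, push_single]
  rfl

theorem tupleMap_prodMap_atHeight {R R' : Type*} (f : R → R') (s : unitInterval) {n : ℕ} (c : TupleChain R n) :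
    tupleMap (Prod.map f id) n (tupleMap (fun x => (x, s)) n c) =
      tupleMap (fun x => (x, s)) n (tupleMap f n c) :=
  linearMap_eq_of_single (f := tupleMap _ n ∘ₗ tupleMap _ n)
    (g := tupleMap _ n ∘ₗ tupleMap _ n) (fun v => by
      simp only [LinearMap.comp_apply, tupleMap_single]; rfl) c

/-- The prism on a chain of tuples. -/
noncomputable def tuplePrism (S : Type*) (n : ℕ) :
    TupleChain S n →ₗ[ℤ] TupleChain (S × unitInterval) (n + 1) :=
  tupleHtpy (fun n => tupleMap (fun x => (x, 0)) n) (fun n => tupleMap (fun x => (x, 1)) n)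
    (fun _ v => (v 0, 0)) n

theorem tupleBdry_tuplePrism (S : Type*) {n : ℕ} (c : TupleChain S (n + 1)) :
    tupleBdry _ (n + 1) (tuplePrism S (n + 1) c) = tupleMap (fun x => (x, 1)) (n + 1) c -
      tupleMap (fun x => (x, 0)) (n + 1) c - tuplePrism S n (tupleBdry S n c) := by
  refine tupleBdry_tupleHtpy ?_ (fun _ c => tupleBdry_tupleMap _ c)
    (fun _ c => tupleBdry_tupleMap _ c) c
  refine LinearMap.ext fun c => linearMap_eq_of_single (fun v => ?_) c
  rw [tupleMap_single, tupleMap_single]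
  congr 1
  exact Subsingleton.elim _ _

theorem tupleMap_tuplePrism {R R' : Type*} (f : R → R') {n : ℕ} (c : TupleChain R n) :
    tupleMap (Prod.map f id) (n + 1) (tuplePrism R n c) = tuplePrism R' n (tupleMap f n c) :=
  tupleMap_tupleHtpy _ _ (fun _ => tupleMap_prodMap_atHeight f 0)
    (fun _ => tupleMap_prodMap_atHeight f 1) (fun _ _ => rfl) c

/-- The prism operator. -/
noncomputable def prism (X : Type*) [TopologicalSpace X] (n : ℕ) :
    Chain X n →ₗ[ℤ] Chain (X × unitInterval) (n + 1) :=
  tupleOp (fun σ => σ.prodMap (ContinuousMap.id unitInterval)) (tuplePrism _ n (vertsChain n))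

theorem bdry_prism {n : ℕ} (c : Chain X (n + 1)) :
    bdry _ (n + 1) (prism X (n + 1) c) =
      push (atHeight X 1) (n + 1) c - push (atHeight X 0) (n + 1) c - prism X n (bdry X n c) := by
  rw [prism, prism, bdry_tupleOp, tupleBdry_tuplePrism, tupleOp_bdry _
    (fun σ => σ.prodMap (ContinuousMap.id unitInterval))
    (fun i => (splxMap i.succAbove).prodMap (ContinuousMap.id unitInterval))
    (fun i => (preservesComb_splxMap _).prodMap_id _) (fun _ _ => rfl),
    sum_tupleMap_vertsChain (tuplePrism _ n) (tuplePrism _ n)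
      (fun i => (splxMap i.succAbove).prodMap (ContinuousMap.id unitInterval)) fun i =>
      tupleMap_tuplePrism (splxMap i.succAbove),
    tupleOp_sub, tupleOp_sub, tupleOp_atHeight, tupleOp_atHeight]

theorem push_prism (f : C(X, Y)) {n : ℕ} (c : Chain X n) :
    push (f.prodMap (ContinuousMap.id unitInterval)) (n + 1) (prism X n c) =
      prism Y n (push f n c) :=
  push_tupleOp (fun σ => σ.prodMap (ContinuousMap.id unitInterval))
    (fun σ => σ.prodMap (ContinuousMap.id unitInterval)) f
    (f.prodMap (ContinuousMap.id unitInterval)) (fun _ => rfl) _ c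

end SingularChain

namespace SingularChain

open BarycentricSpace

/-! ### Mesh of subdivisions -/

/-- A linear map carries chains supported in `s` into a submodule if it does so on generators. -/
theorem map_mem_of_supported {ι M : Type*} [AddCommGroup M] {s : Set ι} {p : Submodule ℤ M}
    {L : (ι →₀ ℤ) →ₗ[ℤ] M} (h : ∀ i ∈ s, L (Finsupp.single i 1) ∈ p) {c : ι →₀ ℤ}
    (hc : c ∈ Finsupp.supported ℤ ℤ s) : L c ∈ p := by
  rw [Finsupp.supported_eq_span_single] at hc
  refine (Submodule.span_le (p := p.comap L)).2 ?_ hc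
  rintro _ ⟨i, hi, rfl⟩
  exact h i hi

/-- The chains of tuples with values in `K`. -/
def tuplesIn {S : Type*} (K : Set S) (n : ℕ) : Submodule ℤ (TupleChain S n) :=
  Finsupp.supported ℤ ℤ {v | ∀ i, v i ∈ K}

/-- The chains of tuples of diameter at most `r`. -/
def tuplesMesh (S : Type*) [PseudoMetricSpace S] (r : ℝ) (n : ℕ) :
    Submodule ℤ (TupleChain S n) :=
  Finsupp.supported ℤ ℤ {v | ∀ i j, dist (v i) (v j) ≤ r}

theorem single_mem_supported {ι : Type*} {s : Set ι} {i : ι} (h : i ∈ s) :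
    Finsupp.single i (1 : ℤ) ∈ Finsupp.supported ℤ ℤ s :=
  Finsupp.single_mem_supported ℤ 1 h

theorem tupleBdry_single_mem {S : Type*} {n : ℕ} {s : Set (Fin n → S)} {v : Fin (n + 1) → S}
    (h : ∀ i : Fin (n + 1), v ∘ i.succAbove ∈ s) :
    tupleBdry S n (Finsupp.single v 1) ∈ Finsupp.supported ℤ ℤ s := by
  rw [tupleBdry_single, one_smul]
  exact Submodule.sum_mem _ fun i _ => Submodule.smul_mem _ _ (single_mem_supported (h i))

theorem coe_comb_mem {k n : ℕ} {K : Set (Fin k → ℝ)} (hK : Convex ℝ K) {v : Fin n → Splx k}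
    (hv : ∀ i, (v i).1 ∈ K) (t : Splx n) : (comb v t).1 ∈ K :=
  hK.sum_mem (fun i _ => t.2.1 i) t.2.2 fun i _ => hv i

theorem tupleSd_mem_tuplesIn {k : ℕ} {K : Set (Fin k → ℝ)} (hK : Convex ℝ K) {n : ℕ}
    {c : TupleChain (Splx k) n} (hc : c ∈ tuplesIn (Subtype.val ⁻¹' K : Set (Splx k)) n) :
    tupleSd centroid n c ∈ tuplesIn (Subtype.val ⁻¹' K : Set (Splx k)) n := by
  induction n with
  | zero => exact hc
  | succ n ih =>
    refine map_mem_of_supported (fun v hv => ?_) hc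
    rw [tupleSd_single]
    refine map_mem_of_supported (fun w hw => ?_)
      (ih (tupleBdry_single_mem fun i j => hv (i.succAbove j)))
    rw [tupleCone_single]
    refine single_mem_supported fun i => ?_
    refine Fin.cases ?_ (fun i => ?_) i
    · exact coe_comb_mem hK hv _
    · exact hw i

/-- The difference between `v i` and the centroid is the average of the `n + 1` differences `v i - v
j`. One of them is zero and the others have norm at most `r`. -/
theorem dist_centroid_le {k n : ℕ} {r : ℝ} {v : Fin (n + 1) → Splx k}
    (hv : ∀ i j, dist (v i) (v j) ≤ r) (i : Fin (n + 1)) :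
    dist (v i) (centroid n v) ≤ (n / (n + 1) : ℝ) * r := by
  have hn : (0 : ℝ) < n + 1 := by positivity
  have h1 : (centroid n v).1 =
      (n + 1 : ℝ)⁻¹ • ∑ j, (v j).1 := by
    rw [Finset.smul_sum]
    change ∑ j, (stdSimplex.barycenter : Splx (n + 1)).1 j • (v j).1 = _
    refine Finset.sum_congr rfl fun j _ => ?_
    rw [stdSimplex.barycenter_apply]
    simp
  have h2 : (v i).1 - (centroid n v).1 =
      (n + 1 : ℝ)⁻¹ • ∑ j, ((v i).1 - (v j).1) := by
    rw [h1, Finset.sum_sub_distrib, smul_sub, Finset.sum_const, Finset.card_univ,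
      Fintype.card_fin, ← Nat.cast_smul_eq_nsmul ℝ, smul_smul]
    push_cast
    rw [inv_mul_cancel₀ hn.ne', one_smul]
  rw [Subtype.dist_eq, dist_eq_norm, h2, norm_smul, Real.norm_of_nonneg (by positivity),
    div_mul_eq_mul_div, inv_mul_eq_div]
  refine div_le_div_of_nonneg_right ?_ hn.le
  rw [Fin.sum_univ_succAbove _ i, sub_self, zero_add]
  refine (norm_sum_le_of_le _ fun j _ => ?_).trans (b := ∑ _ : Fin n, r) (by simp)
  rw [← dist_eq_norm]
  exact hv _ _

/-- An edge of the subdivision either avoids the apex, and is controlled by induction, or joins the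
centroid to a point of the subdivided boundary, which stays in the convex ball of radius `n / (n +
1) * r` about the centroid. The factor for tuples of length `n` is not sharp; any factor below 1
suffices. -/
theorem tupleSd_mem_tuplesMesh {k n : ℕ} {r : ℝ} {c : TupleChain (Splx k) n}
    (hc : c ∈ tuplesMesh (Splx k) r n) :
    tupleSd centroid n c ∈ tuplesMesh (Splx k) (n / (n + 1) * r) n := by
  induction n with
  | zero =>
    exact map_mem_of_supported (L := LinearMap.id)
      (fun v _ => single_mem_supported fun i => i.elim0) hc
  | succ n ih =>
    refine map_mem_of_supported (fun v hv => ?_) hc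
    have hr : 0 ≤ r := dist_nonneg.trans (hv 0 0)
    rw [tupleSd_single]
    have h1 := ih (tupleBdry_single_mem (s := {v | ∀ i j, dist (v i) (v j) ≤ r}) (v := v)
      fun i j l => hv _ _)
    have h2 := tupleSd_mem_tuplesIn (convex_closedBall
      (centroid n v).1 (n / (n + 1) * r))
      (tupleBdry_single_mem (v := v) fun i j => dist_centroid_le hv (i.succAbove j))
    have h3 : (n / (n + 1) * r : ℝ) ≤ ((n + 1 : ℕ) / ((n + 1 : ℕ) + 1) * r : ℝ) := by
      refine mul_le_mul_of_nonneg_right ?_ hr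
      rw [div_le_div_iff₀ (by positivity) (by positivity)]
      push_cast
      nlinarith
    have h4 := (Finsupp.mem_supported ℤ _).1 h1
    have h5 := (Finsupp.mem_supported ℤ _).1 h2
    refine map_mem_of_supported (fun w hw => ?_)
      ((Finsupp.mem_supported ℤ _).2 (Set.subset_inter h4 h5))
    rw [tupleCone_single]
    refine single_mem_supported fun i j => ?_
    refine Fin.cases (Fin.cases ?_ (fun j => ?_) j) (fun i => Fin.cases ?_ (fun j => ?_) j) i
    · simpa using by positivity
    · rw [dist_comm]; exact (hw.2 j).trans h3
    · exact (hw.2 i).trans h3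
    · exact (hw.1 i j).trans h3

theorem vertsChain_mem_tuplesMesh (n : ℕ) : vertsChain n ∈ tuplesMesh (Splx n) 1 n :=
  single_mem_supported fun _ _ => (Metric.dist_le_diam_of_mem (bounded_stdSimplex _)
    (Subtype.mem _) (Subtype.mem _)).trans diam_stdSimplex_le

theorem iterate_tupleSd_mem_tuplesMesh (n m : ℕ) :
    (tupleSd centroid n)^[m] (vertsChain n) ∈ tuplesMesh (Splx n) ((n / (n + 1)) ^ m) n := by
  induction m with
  | zero => simpa using vertsChain_mem_tuplesMesh n
  | succ m ih =>
    rw [Function.iterate_succ_apply', pow_succ']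
    exact tupleSd_mem_tuplesMesh ih

/-- Affine maps compose. Consequently subdividing an affine singular simplex is the same as
subdividing its tuple of vertices. -/
theorem preservesComb_comb {k n : ℕ} (v : Fin n → Splx k) : PreservesComb (comb v) := by
  intro m w
  ext t j
  change (∑ i, (∑ l, t l • ((w l : Splx n) : Fin n → ℝ)) i • ((v i : Splx k) : Fin k → ℝ)) j =
    (∑ l, t l • ∑ i, ((w l : Splx n) : Fin n → ℝ) i • ((v i : Splx k) : Fin k → ℝ)) j
  simp only [Finset.sum_apply, Finset.sum_smul, Finset.smul_sum, Pi.smul_apply, smul_smul,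
    smul_eq_mul]
  exact Finset.sum_comm

theorem comb_comp_verts {k n : ℕ} (v : Fin n → Splx k) : comb v ∘ verts n = v := by
  funext i
  ext j
  change (∑ l, (Pi.single i (1 : ℝ) : Fin n → ℝ) l • (v l).1) j = (v i).1 j
  simp [Pi.single_apply, Finset.sum_apply, ite_apply]

theorem sd_realize {k n : ℕ} (c : TupleChain (Splx k) n) :
    sd (Splx k) n (realize (Splx k) n c) = realize (Splx k) n (tupleSd centroid n c) :=
  linearMap_eq_of_single (f := sd _ n ∘ₗ realize _ n) (g := realize _ n ∘ₗ tupleSd centroid n)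
    (fun v => by
      simp only [LinearMap.comp_apply, realize_single, sd, tupleOp_single, one_smul,
        (preservesComb_comb v).push_realize, (preservesComb_comb v).tupleMap_tupleSd,
        tupleMap_single, comb_comp_verts]) c

variable {X Y Z : Type*} [TopologicalSpace X] [TopologicalSpace Y] [TopologicalSpace Z]

theorem iterate_sd_single {n : ℕ} (σ : C(Splx n, X)) (m : ℕ) :
    (sd X n)^[m] (Finsupp.single σ 1) =
      push σ n (realize _ n ((tupleSd centroid n)^[m] (vertsChain n))) := by
  induction m with
  | zero => simp [comb_verts]
  | succ m ih =>
    rw [Function.iterate_succ_apply', Function.iterate_succ_apply', ih, ← push_sd, sd_realize]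

/-! ### Chains supported in a subset -/

/-- The singular chains on simplices contained in `W`. -/
def chainsIn (W : Set X) (n : ℕ) : Submodule ℤ (Chain X n) :=
  Finsupp.supported ℤ ℤ {σ | ∀ t, σ t ∈ W}

theorem chainsIn_mono {W W' : Set X} (h : W ⊆ W') (n : ℕ) : chainsIn W n ≤ chainsIn W' n :=
  Finsupp.supported_mono fun _ hσ t => h (hσ t)

theorem mem_chainsIn_univ {n : ℕ} (c : Chain X n) : c ∈ chainsIn Set.univ n :=
  (Finsupp.mem_supported ℤ c).2 fun _ _ _ => Set.mem_univ _

theorem mem_chainsIn_inter {U V : Set X} {n : ℕ} {c : Chain X n} (hU : c ∈ chainsIn U n)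
    (hV : c ∈ chainsIn V n) : c ∈ chainsIn (U ∩ V) n :=
  (Finsupp.mem_supported ℤ c).2 fun _ hσ t =>
    ⟨(Finsupp.mem_supported ℤ c).1 hU hσ t, (Finsupp.mem_supported ℤ c).1 hV hσ t⟩

theorem push_mem_chainsIn {f : C(X, Y)} {W : Set X} {W' : Set Y} (h : Set.MapsTo f W W') {n : ℕ}
    {c : Chain X n} (hc : c ∈ chainsIn W n) : push f n c ∈ chainsIn W' n :=
  map_mem_of_supported (fun σ hσ => by
    rw [push_single]
    exact single_mem_supported fun t => h (hσ t)) hc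

theorem bdry_mem_chainsIn {W : Set X} {n : ℕ} {c : Chain X (n + 1)}
    (hc : c ∈ chainsIn W (n + 1)) : bdry X n c ∈ chainsIn W n :=
  map_mem_of_supported (fun σ hσ => by
    rw [bdry_single, one_smul]
    exact Submodule.sum_mem _ fun i _ => Submodule.smul_mem _ _
      (single_mem_supported fun t => hσ _)) hc

theorem tupleOp_mem_chainsIn {S : Type*} [TopologicalSpace S] [BarycentricSpace S] {n m : ℕ}
    {Φ : C(Splx n, X) → C(S, Y)} {u : TupleChain S m} {W : Set X} {W' : Set Y}
    (h : ∀ σ : C(Splx n, X), (∀ t, σ t ∈ W) → ∀ s, Φ σ s ∈ W') {c : Chain X n}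
    (hc : c ∈ chainsIn W n) : tupleOp Φ u c ∈ chainsIn W' m :=
  map_mem_of_supported (fun σ hσ => by
    rw [tupleOp_single, one_smul]
    exact push_mem_chainsIn (fun s _ => h σ hσ s) (mem_chainsIn_univ _)) hc

theorem sd_mem_chainsIn {W : Set X} {n : ℕ} {c : Chain X n} (hc : c ∈ chainsIn W n) :
    sd X n c ∈ chainsIn W n :=
  tupleOp_mem_chainsIn (fun _ h => h) hc

theorem sdHtpy_mem_chainsIn {W : Set X} {n : ℕ} {c : Chain X n} (hc : c ∈ chainsIn W n) :
    sdHtpy X n c ∈ chainsIn W (n + 1) :=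
  tupleOp_mem_chainsIn (fun _ h => h) hc

/-! ### Small chains -/

theorem sd_mem_sup {U V : Set X} {n : ℕ} {c : Chain X n}
    (hc : c ∈ chainsIn U n ⊔ chainsIn V n) : sd X n c ∈ chainsIn U n ⊔ chainsIn V n := by
  obtain ⟨a, ha, b, hb, rfl⟩ := Submodule.mem_sup.1 hc
  rw [map_add]
  exact Submodule.add_mem_sup (sd_mem_chainsIn ha) (sd_mem_chainsIn hb)

theorem iterate_sd_mem_sup {U V : Set X} {n : ℕ} {c : Chain X n}
    (hc : c ∈ chainsIn U n ⊔ chainsIn V n) (m : ℕ) :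
    (sd X n)^[m] c ∈ chainsIn U n ⊔ chainsIn V n := by
  induction m with
  | zero => exact hc
  | succ m ih => rw [Function.iterate_succ_apply']; exact sd_mem_sup ih

/-- A Lebesgue number for the cover of the simplex by the preimages of `U` and `V` eventually
exceeds the mesh of the iterated subdivision. -/
theorem exists_iterate_sd_single_mem_sup {U V : Set X} (hU : IsOpen U) (hV : IsOpen V) {n : ℕ}
    {σ : C(Splx n, X)} (hσ : ∀ t, σ t ∈ U ∪ V) :
    ∃ m, (sd X n)^[m] (Finsupp.single σ 1) ∈ chainsIn U n ⊔ chainsIn V n := by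
  obtain ⟨δ, hδ, h⟩ := lebesgue_number_lemma_of_metric (s := Set.univ)
    (c := fun b : Bool => cond b (σ ⁻¹' U) (σ ⁻¹' V)) isCompact_univ
    (fun b => by cases b; exacts [hV.preimage σ.continuous, hU.preimage σ.continuous])
    (fun t _ => by
      rcases hσ t with h | h
      · exact Set.mem_iUnion.2 ⟨true, h⟩
      · exact Set.mem_iUnion.2 ⟨false, h⟩)
  obtain ⟨m, hm⟩ := exists_pow_lt_of_lt_one hδ (show (n / (n + 1) : ℝ) < 1 by
    rw [div_lt_one (by positivity)]; linarith)
  refine ⟨m, ?_⟩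
  rw [iterate_sd_single]
  refine map_mem_of_supported (L := push σ n ∘ₗ realize _ n) (fun w hw => ?_)
    (iterate_tupleSd_mem_tuplesMesh n m)
  rw [LinearMap.comp_apply, realize_single, push_single]
  rcases Nat.eq_zero_or_pos n with rfl | hn
  -- The simplex without vertices has no points, so the empty simplex lies in `U` vacuously.
  · exact Submodule.mem_sup_left (single_mem_supported fun t => by
      have := stdSimplex.sum_eq_one t
      simp at this)
  · have hball (t : Splx n) : comb w t ∈ Metric.ball (w ⟨0, hn⟩) δ := by
      refine Metric.closedBall_subset_ball hm ?_
      exact coe_comb_mem (convex_closedBall (w ⟨0, hn⟩).1 _)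
        (fun i => hw i _) t
    obtain ⟨b, hb⟩ := h (w ⟨0, hn⟩) (Set.mem_univ _)
    cases b
    · exact Submodule.mem_sup_right (single_mem_supported fun t => hb (hball t))
    · exact Submodule.mem_sup_left (single_mem_supported fun t => hb (hball t))

theorem iterate_sd_eq_pow {n : ℕ} (m : ℕ) (c : Chain X n) : (sd X n)^[m] c = (sd X n ^ m) c :=
  (Module.End.pow_apply _ _ _).symm

/-- Every chain in `U ∪ V` becomes a sum of chains in `U` and `V` after enough subdivisions. -/
theorem exists_iterate_sd_mem_sup {U V : Set X} (hU : IsOpen U) (hV : IsOpen V) {n : ℕ}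
    {c : Chain X n} (hc : c ∈ chainsIn (U ∪ V) n) :
    ∃ m, (sd X n)^[m] c ∈ chainsIn U n ⊔ chainsIn V n := by
  rw [chainsIn, Finsupp.supported_eq_span_single] at hc
  induction hc using Submodule.span_induction with
  | mem _ h =>
    obtain ⟨σ, hσ, rfl⟩ := h
    exact exists_iterate_sd_single_mem_sup hU hV hσ
  | zero => exact ⟨0, Submodule.zero_mem _⟩
  | add a b _ _ ha hb =>
    obtain ⟨m, hm⟩ := ha
    obtain ⟨k, hk⟩ := hb
    refine ⟨m + k, ?_⟩
    rw [iterate_sd_eq_pow, map_add, ← iterate_sd_eq_pow, ← iterate_sd_eq_pow]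
    refine Submodule.add_mem _ ?_ ?_
    · rw [add_comm, Function.iterate_add_apply]; exact iterate_sd_mem_sup hm k
    · rw [Function.iterate_add_apply]; exact iterate_sd_mem_sup hk m
  | smul r a _ ha =>
    obtain ⟨m, hm⟩ := ha
    refine ⟨m, ?_⟩
    rw [iterate_sd_eq_pow, map_smul, ← iterate_sd_eq_pow]
    exact Submodule.smul_mem _ _ hm

end SingularChain

namespace SingularChain

variable {X Y Z : Type*} [TopologicalSpace X] [TopologicalSpace Y] [TopologicalSpace Z]

/-! ### Mayer-Vietoris arguments -/

/-- Iterated subdivision is naturally homotopic to the identity. -/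
theorem exists_iterate_sd_htpy (X : Type*) [TopologicalSpace X] (m : ℕ) :
    ∃ T : ∀ n, Chain X n →ₗ[ℤ] Chain X (n + 1),
      (∀ n c, bdry X (n + 1) (T (n + 1) c) = (sd X (n + 1))^[m] c - c - T n (bdry X n c)) ∧
      (∀ W n, ∀ c ∈ chainsIn W n, T n c ∈ chainsIn W (n + 1)) ∧
      ∀ (g : C(X, X)) n c, push g (n + 1) (T n c) = T n (push g n c) := by
  have hb (m n : ℕ) (c : Chain X (n + 1)) :
      (sd X n)^[m] (bdry X n c) = bdry X n ((sd X (n + 1))^[m] c) := by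
    induction m with
    | zero => rfl
    | succ m ih => rw [Function.iterate_succ_apply', Function.iterate_succ_apply', ih, sd_bdry]
  have hp (m n : ℕ) (g : C(X, X)) (c : Chain X n) :
      push g n ((sd X n)^[m] c) = (sd X n)^[m] (push g n c) := by
    induction m with
    | zero => rfl
    | succ m ih => rw [Function.iterate_succ_apply', Function.iterate_succ_apply', push_sd, ih]
  have hW (m n : ℕ) (W : Set X) (c : Chain X n) (hc : c ∈ chainsIn W n) :
      (sd X n)^[m] c ∈ chainsIn W n := by
    induction m with
    | zero => exact hc
    | succ m ih => rw [Function.iterate_succ_apply']; exact sd_mem_chainsIn ih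
  induction m with
  | zero => exact ⟨fun _ => 0, by simp, by simp, by simp⟩
  | succ m ih =>
    obtain ⟨T, h1, h2, h3⟩ := ih
    refine ⟨fun n => T n + sdHtpy X n ∘ₗ (sd X n ^ m), fun n c => ?_, fun W n c hc => ?_,
      fun g n c => ?_⟩
    · simp only [LinearMap.add_apply, LinearMap.comp_apply, ← iterate_sd_eq_pow, map_add, h1,
        bdry_sdHtpy, Function.iterate_succ_apply', hb]
      abel
    · simp only [LinearMap.add_apply, LinearMap.comp_apply, ← iterate_sd_eq_pow]
      exact Submodule.add_mem _ (h2 W n c hc) (sdHtpy_mem_chainsIn (hW m n W c hc))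
    · simp only [LinearMap.add_apply, LinearMap.comp_apply, ← iterate_sd_eq_pow, map_add, h3,
        push_sdHtpy, hp]

/-- An invariant cycle in a union of two open sets is homologous to a small one. -/
theorem exists_small_cycle {U V : Set X} (hU : IsOpen U) (hV : IsOpen V) (g : C(X, X)) {n : ℕ}
    {c : Chain X (n + 1)} (hc : c ∈ chainsIn (U ∪ V) (n + 1)) (hg : push g (n + 1) c = c)
    (hb : bdry X n c = 0) :
    ∃ e ∈ chainsIn (U ∪ V) (n + 2), push g (n + 2) e = e ∧
      c + bdry X (n + 1) e ∈ chainsIn U (n + 1) ⊔ chainsIn V (n + 1) := by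
  obtain ⟨m, hm⟩ := exists_iterate_sd_mem_sup hU hV hc
  obtain ⟨T, h1, h2, h3⟩ := exists_iterate_sd_htpy X m
  -- On a cycle, adding the boundary of `T c` replaces `c` by its iterated subdivision; naturality
  -- of `T` keeps this correction invariant.
  refine ⟨T _ c, h2 _ _ c hc, by rw [h3, hg], ?_⟩
  rw [h1, hb, map_zero]
  convert hm using 1
  abel

/-- A small chain that bounds in a union of two open sets bounds a small chain. -/
theorem exists_small_bounding {U V : Set X} (hU : IsOpen U) (hV : IsOpen V) {n : ℕ}
    {b : Chain X (n + 1)} (hb : b ∈ chainsIn (U ∪ V) (n + 1))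
    (hc : bdry X n b ∈ chainsIn U n ⊔ chainsIn V n) :
    ∃ b' ∈ chainsIn U (n + 1) ⊔ chainsIn V (n + 1), bdry X n b' = bdry X n b := by
  obtain ⟨m, hm⟩ := exists_iterate_sd_mem_sup hU hV hb
  obtain ⟨T, h1, h2, h3⟩ := exists_iterate_sd_htpy X m
  -- Subdividing `b` alters its boundary. Subtracting `T` of the boundary of `b` restores it, and
  -- this term is small because `T` preserves supports.
  refine ⟨(sd X (n + 1))^[m] b - T n (bdry X n b), Submodule.sub_mem _ hm ?_, ?_⟩
  · obtain ⟨a, ha, a', ha', h⟩ := Submodule.mem_sup.1 hc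
    rw [← h, map_add]
    exact Submodule.add_mem_sup (h2 _ _ _ ha) (h2 _ _ _ ha')
  · have h := congrArg (bdry X n) (h1 n b)
    rw [bdry_bdry, map_sub, map_sub] at h
    rw [map_sub, ← sub_eq_zero]
    rw [h]
    abel

/-- Since `U` is its own preimage, `σ` lies in `U` exactly when `g ∘ σ` does. This makes the
splitting of a small chain by supports compatible with `g`. -/
theorem push_filter (g : C(X, X)) {U : Set X} (hU : g ⁻¹' U = U) {n : ℕ} (c : Chain X n) :
    haveI := Classical.decPred fun σ : C(Splx n, X) => ∀ t, σ t ∈ U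
    push g n (c.filter fun σ => ∀ t, σ t ∈ U) = (push g n c).filter fun σ => ∀ t, σ t ∈ U := by
  classical
  have hmem (x : X) : g x ∈ U ↔ x ∈ U := by rw [← Set.mem_preimage, hU]
  induction c using Finsupp.induction_linear with
  | zero => simp only [map_zero, Finsupp.filter_zero]
  | add a b ha hb => simp only [Finsupp.filter_add, map_add] at ha hb ⊢; rw [ha, hb]
  | single σ k =>
    by_cases h : ∀ t, σ t ∈ U
    · rw [Finsupp.filter_single_of_pos (fun σ : C(Splx n, X) => ∀ t, σ t ∈ U) h, push_single,
        Finsupp.filter_single_of_pos (fun σ : C(Splx n, X) => ∀ t, σ t ∈ U)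
          (fun t => (hmem _).2 (h t))]
    · rw [Finsupp.filter_single_of_neg (fun σ : C(Splx n, X) => ∀ t, σ t ∈ U) h, push_single,
        Finsupp.filter_single_of_neg (fun σ : C(Splx n, X) => ∀ t, σ t ∈ U)
          (fun h' => h fun t => (hmem _).1 (h' t)), map_zero]

/-- An invariant small chain is a sum of invariant chains in the two sets. -/
theorem exists_invariant_add {U V : Set X} (g : C(X, X)) (hU : g ⁻¹' U = U) {n : ℕ}
    {c : Chain X n} (hc : c ∈ chainsIn U n ⊔ chainsIn V n) (hg : push g n c = c) :
    ∃ a ∈ chainsIn U n, ∃ b ∈ chainsIn V n, push g n a = a ∧ push g n b = b ∧ a + b = c := by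
  classical
  have h1 : push g n (c.filter fun σ => ∀ t, σ t ∈ U) = c.filter fun σ => ∀ t, σ t ∈ U := by
    convert push_filter g hU c
    exact hg.symm
  have h2 := Finsupp.filter_add_filter_not c fun σ => ∀ t, σ t ∈ U
  refine ⟨_, (Finsupp.mem_supported ℤ _).2 fun σ hσ => ?_, _,
    (Finsupp.mem_supported ℤ _).2 fun σ hσ => ?_, h1, ?_, h2⟩
  · simp only [Finsupp.support_filter, Finset.coe_filter] at hσ
    exact hσ.2
  · simp only [Finsupp.support_filter, Finset.coe_filter] at hσ
    rw [chainsIn, chainsIn, ← Finsupp.supported_union] at hc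
    exact ((Finsupp.mem_supported ℤ c).1 hc hσ.1).resolve_left hσ.2
  · rw [← eq_sub_iff_add_eq'] at h2
    rw [h2, map_sub, hg, h1]

/-- Invariant cycles of dimension at least `k` in `W` are boundaries of invariant chains. -/
def InvariantlyBounds (g : C(X, X)) (W : Set X) (k : ℕ) : Prop :=
  ∀ n, k ≤ n → ∀ c ∈ chainsIn W (n + 1), push g (n + 1) c = c → bdry X n c = 0 →
    ∃ b ∈ chainsIn W (n + 2), push g (n + 2) b = b ∧ bdry X (n + 1) b = c

theorem InvariantlyBounds.mono {g : C(X, X)} {W : Set X} {k l : ℕ} (hkl : k ≤ l)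
    (h : InvariantlyBounds g W k) : InvariantlyBounds g W l :=
  fun n hn => h n (hkl.trans hn)

/-- This is the Mayer-Vietoris argument on invariant chains. After subdivision the cycle is `a + b`
with both parts invariant; `∂a = -∂b` is an invariant cycle in `U ∩ V` one dimension lower. If `w`
bounds it there, then `a - w` and `b + w` are invariant cycles in `U` and `V`. The drop in dimension
is the reason for `k` in one hypothesis and `k + 1` in the conclusion. -/
theorem InvariantlyBounds.union {g : C(X, X)} {U V : Set X} {k : ℕ} (hUo : IsOpen U)
    (hVo : IsOpen V) (hgU : g ⁻¹' U = U) (hU : InvariantlyBounds g U (k + 1))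
    (hV : InvariantlyBounds g V (k + 1)) (hUV : InvariantlyBounds g (U ∩ V) k) :
    InvariantlyBounds g (U ∪ V) (k + 1) := by
  intro n hn c hc hg hb
  obtain ⟨n, rfl⟩ := Nat.exists_eq_succ_of_ne_zero (by omega : n ≠ 0)
  obtain ⟨e, he, hge, hs⟩ := exists_small_cycle hUo hVo g hc hg hb
  obtain ⟨a, ha, b, hb', hga, hgb, hab⟩ := exists_invariant_add g hgU hs (by
    rw [map_add, hg, ← bdry_push, hge])
  have hab0 : bdry X (n + 1) a = -bdry X (n + 1) b := by
    rw [eq_neg_iff_add_eq_zero, ← map_add, hab, map_add, hb, bdry_bdry, add_zero]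
  obtain ⟨w, hw, hgw, hbw⟩ := hUV n (by omega) (bdry X (n + 1) a)
    (mem_chainsIn_inter (bdry_mem_chainsIn ha)
      (hab0 ▸ Submodule.neg_mem _ (bdry_mem_chainsIn hb')))
    (by rw [← bdry_push, hga]) (bdry_bdry a)
  obtain ⟨a', ha', hga', hba'⟩ := hU (n + 1) (by omega) (a - w)
    (Submodule.sub_mem _ ha (chainsIn_mono Set.inter_subset_left _ hw))
    (by rw [map_sub, hga, hgw]) (by rw [map_sub, hbw, sub_self])
  obtain ⟨b', hb'', hgb', hbb'⟩ := hV (n + 1) (by omega) (b + w)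
    (Submodule.add_mem _ hb' (chainsIn_mono Set.inter_subset_right _ hw))
    (by rw [map_add, hgb, hgw]) (by rw [map_add, hbw, hab0, add_neg_cancel])
  refine ⟨a' + b' - e, Submodule.sub_mem _ (Submodule.add_mem _
    (chainsIn_mono Set.subset_union_left _ ha') (chainsIn_mono Set.subset_union_right _ hb''))
    he, by rw [map_sub, map_add, hga', hgb', hge], ?_⟩
  rw [map_sub, map_add, hba', hbb', eq_sub_of_add_eq hab.symm]
  abel

/-- A chain is a cycle of the augmented complex. -/
def IsCycle : ∀ {n : ℕ}, Chain X n → Prop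
  | 0, _ => True
  | n + 1, c => bdry X n c = 0

theorem isCycle_bdry {n : ℕ} (c : Chain X (n + 1)) : IsCycle (bdry X n c) := by
  cases n with
  | zero => trivial
  | succ n => exact bdry_bdry c

/-- The augmented singular complex of `W` is acyclic. -/
def Acyclic (W : Set X) : Prop :=
  ∀ n, ∀ c ∈ chainsIn W n, IsCycle c → ∃ b ∈ chainsIn W (n + 1), bdry X n b = c

/-- The homology of the augmented singular complex of `W` on simplices with `n` vertices is
infinite cyclic. -/
def InfiniteCyclic (W : Set X) (n : ℕ) : Prop :=
  ∃ z ∈ chainsIn W n, IsCycle z ∧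
    (∀ c ∈ chainsIn W n, IsCycle c → ∃ k : ℤ, ∃ b ∈ chainsIn W (n + 1), c = k • z + bdry X n b) ∧
    ∀ k : ℤ, ∀ b ∈ chainsIn W (n + 1), bdry X n b = k • z → k = 0

/-- With both pieces acyclic, the connecting homomorphism is an isomorphism. The generator is `a -
b`, where `a` in `U` and `b` in `V` both bound the generator `z` of the intersection. -/
theorem InfiniteCyclic.union {U V : Set X} {n : ℕ} (hUo : IsOpen U) (hVo : IsOpen V)
    (hU : Acyclic U) (hV : Acyclic V) (hUV : InfiniteCyclic (U ∩ V) n) :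
    InfiniteCyclic (U ∪ V) (n + 1) := by
  obtain ⟨z, hz, hcz, hgen, hinf⟩ := hUV
  obtain ⟨a, ha, hab⟩ := hU n z (chainsIn_mono Set.inter_subset_left _ hz) hcz
  obtain ⟨b, hb, hbb⟩ := hV n z (chainsIn_mono Set.inter_subset_right _ hz) hcz
  have hsub {m : ℕ} {u v : Chain X m} (hu : u ∈ chainsIn U m) (hv : v ∈ chainsIn V m) :
      u + v ∈ chainsIn (U ∪ V) m := Submodule.add_mem _
    (chainsIn_mono Set.subset_union_left _ hu) (chainsIn_mono Set.subset_union_right _ hv)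
  have hz' : bdry X n (a + -b) = 0 := by rw [map_add, map_neg, hab, hbb, add_neg_cancel]
  refine ⟨a + -b, hsub ha (Submodule.neg_mem _ hb), hz', fun c hc hcc => ?_, fun k w hw hwk => ?_⟩
  · obtain ⟨e, he, -, hs⟩ := exists_small_cycle hUo hVo (ContinuousMap.id X) hc (push_id c) hcc
    obtain ⟨u, hu, v, hv, huv⟩ := Submodule.mem_sup.1 hs
    have huv0 : bdry X n u = -bdry X n v := by
      have hcc' : bdry X n c = 0 := hcc
      rw [eq_neg_iff_add_eq_zero, ← map_add, huv, map_add, hcc', bdry_bdry, add_zero]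
    obtain ⟨k, w, hw, hk⟩ := hgen (bdry X n u)
      (mem_chainsIn_inter (bdry_mem_chainsIn hu)
        (huv0 ▸ Submodule.neg_mem _ (bdry_mem_chainsIn hv))) (isCycle_bdry u)
    have hwU := chainsIn_mono Set.inter_subset_left _ hw
    have hwV := chainsIn_mono Set.inter_subset_right _ hw
    obtain ⟨u', hu', hbu'⟩ := hU (n + 1) (u - k • a - w) (Submodule.sub_mem _
      (Submodule.sub_mem _ hu (Submodule.smul_mem _ k ha)) hwU)
      (show bdry X n _ = 0 by rw [map_sub, map_sub, map_smul, hab, hk]; abel)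
    obtain ⟨v', hv', hbv'⟩ := hV (n + 1) (v + k • b + w) (Submodule.add_mem _
      (Submodule.add_mem _ hv (Submodule.smul_mem _ k hb)) hwV)
      (show bdry X n _ = 0 by
        rw [map_add, map_add, map_smul, hbb, ← neg_eq_iff_eq_neg.2 huv0, hk]; abel)
    refine ⟨k, u' + v' - e, Submodule.sub_mem _ (hsub hu' hv') he, ?_⟩
    rw [map_sub, map_add, hbu', hbv', eq_sub_of_add_eq huv.symm]
    module
  -- Take a small bounding chain `u + v` of `k • (a - b)`. Then `k • a - ∂u = k • b + ∂v` lies in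
  -- both sets, hence in the intersection, and its boundary is `k • z`.
  · obtain ⟨w', hw', hbw'⟩ := exists_small_bounding hUo hVo hw (by
      rw [hwk, smul_add]
      exact Submodule.add_mem_sup (Submodule.smul_mem _ k ha)
        (Submodule.smul_mem _ k (Submodule.neg_mem _ hb)))
    obtain ⟨u, hu, v, hv, rfl⟩ := Submodule.mem_sup.1 hw'
    have h1 : k • a - bdry X (n + 1) u = k • b + bdry X (n + 1) v := by
      rw [hwk, map_add] at hbw'
      rw [sub_eq_iff_eq_add, add_assoc, add_comm (bdry X (n + 1) v), hbw']
      module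
    refine hinf k (k • a - bdry X (n + 1) u) (mem_chainsIn_inter
      (Submodule.sub_mem _ (Submodule.smul_mem _ k ha) (bdry_mem_chainsIn hu)) ?_) ?_
    · rw [h1]
      exact Submodule.add_mem _ (Submodule.smul_mem _ k hb) (bdry_mem_chainsIn hv)
    · rw [map_sub, map_smul, hab, bdry_bdry, sub_zero]

/-- The empty set plays the role of the sphere of dimension -1: its augmented complex is generated
by the empty simplex alone. -/
theorem infiniteCyclic_empty : InfiniteCyclic (∅ : Set X) 0 := by
  have : IsEmpty (Splx 0) := ⟨fun t => by simpa using stdSimplex.sum_eq_one t⟩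
  let σ : C(Splx 0, X) := ⟨isEmptyElim, continuous_iff_continuousAt.2 isEmptyElim⟩
  have hσ (τ : C(Splx 0, X)) : τ = σ := ContinuousMap.ext isEmptyElim
  refine ⟨Finsupp.single σ 1, single_mem_supported fun t => isEmptyElim t, trivial,
    fun c _ _ => ⟨c σ, 0, Submodule.zero_mem _, ?_⟩, fun k b hb h => ?_⟩
  · ext τ
    simp [hσ τ]
  · have hb0 : b = 0 := by
      rw [← Finsupp.support_eq_empty, Finset.eq_empty_iff_forall_notMem]
      exact fun τ hτ => (Finsupp.mem_supported ℤ b).1 hb hτ (verts 1 0)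
    rw [hb0, map_zero] at h
    simpa using (DFunLike.congr_fun h σ).symm

end SingularChain

namespace SingularChain

variable {X Y Z : Type*} [TopologicalSpace X] [TopologicalSpace Y] [TopologicalSpace Z]

/-! ### Homotopies -/

theorem bdry_push_prism (H : C(X × unitInterval, Y)) {n : ℕ} (c : Chain X (n + 1)) :
    bdry Y (n + 1) (push H (n + 2) (prism X (n + 1) c)) =
      push (H.comp (atHeight X 1)) (n + 1) c - push (H.comp (atHeight X 0)) (n + 1) c -
        push H (n + 1) (prism X n (bdry X n c)) := by
  rw [bdry_push, bdry_prism, map_sub, map_sub, push_push, push_push]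

/-- Homotopic maps send a cycle to homologous cycles. -/
theorem exists_bdry_of_homotopic {f₀ f₁ : C(X, Y)} (h : f₀.Homotopic f₁) {n : ℕ}
    {c : Chain X (n + 1)} (hc : bdry X n c = 0) :
    ∃ b, push f₁ (n + 1) c = push f₀ (n + 1) c + bdry Y (n + 1) b := by
  obtain ⟨F⟩ := h
  let H : C(X × unitInterval, Y) := F.toContinuousMap.comp ContinuousMap.prodSwap
  refine ⟨push H (n + 2) (prism X (n + 1) c), ?_⟩
  have h0 : H.comp (atHeight X 0) = f₀ := ContinuousMap.ext fun x => F.apply_zero x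
  have h1 : H.comp (atHeight X 1) = f₁ := ContinuousMap.ext fun x => F.apply_one x
  rw [bdry_push_prism, h0, h1, hc, map_zero, map_zero]
  abel

/-! ### Constant simplices -/

/-- The chain of constant simplices at the points of a zero-dimensional chain. -/
noncomputable def constChain (X : Type*) [TopologicalSpace X] (n : ℕ) :
    (X →₀ ℤ) →ₗ[ℤ] Chain X n :=
  Finsupp.lmapDomain ℤ ℤ (ContinuousMap.const _)

@[simp]
theorem constChain_single {n : ℕ} (x : X) (k : ℤ) :
    constChain X n (Finsupp.single x k) = Finsupp.single (ContinuousMap.const _ x) k := by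
  simp [constChain]

/-- All `n + 1` faces of a constant simplex coincide, and their signs sum to 1 or 0 according to the
parity of `n`. -/
theorem bdry_constChain {n : ℕ} (x : X →₀ ℤ) :
    bdry X n (constChain X (n + 1) x) = if Even n then constChain X n x else 0 := by
  have h : (bdry X n ∘ₗ constChain X (n + 1)) =
      if Even n then constChain X n else 0 := by
    refine LinearMap.ext (linearMap_eq_of_single fun p => ?_)
    simp only [LinearMap.comp_apply, constChain_single, bdry_single, one_smul,
      ContinuousMap.const_comp, ← Finset.sum_smul]
    rw [Fin.sum_neg_one_pow]
    by_cases hn : Even n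
    · simp [hn, Nat.even_add_one]
    · simp [hn, Nat.even_add_one]
  have := DFunLike.congr_fun h x
  rw [LinearMap.comp_apply] at this
  rw [this]
  split_ifs <;> rfl

/-- The chain of first vertices. -/
noncomputable def firstVertex (X : Type*) [TopologicalSpace X] (n : ℕ) :
    Chain X (n + 1) →ₗ[ℤ] (X →₀ ℤ) :=
  Finsupp.lmapDomain ℤ ℤ fun σ => σ (verts (n + 1) 0)

theorem firstVertex_constChain {n : ℕ} (x : X →₀ ℤ) :
    firstVertex X n (constChain X (n + 1) x) = x :=
  linearMap_eq_of_single (f := firstVertex X n ∘ₗ constChain X (n + 1)) (g := LinearMap.id)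
    (fun p => by simp [firstVertex]) x

theorem constChain_firstVertex {n : ℕ} {c : Chain X (n + 1)}
    (hc : c ∈ Finsupp.supported ℤ ℤ {σ : C(Splx (n + 1), X) | ∀ s t, σ s = σ t}) (m : ℕ)
    (g : C(X, X)) (hg : push g (n + 1) c = c) {W : Set X} (hW : c ∈ chainsIn W (n + 1)) :
    constChain X (n + 1) (firstVertex X n c) = c ∧
      constChain X m (firstVertex X n c) ∈ chainsIn W m ∧
      push g m (constChain X m (firstVertex X n c)) = constChain X m (firstVertex X n c) := by
  refine ⟨?_, ?_, ?_⟩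
  · refine sub_eq_zero.1 (map_mem_of_supported (p := ⊥)
      (L := constChain X (n + 1) ∘ₗ firstVertex X n - LinearMap.id) (fun σ hσ => ?_) hc)
    have h : ContinuousMap.const _ (σ (verts (n + 1) 0)) = σ := ContinuousMap.ext fun t => hσ _ _
    simp [firstVertex, h]
  · refine map_mem_of_supported (L := constChain X m ∘ₗ firstVertex X n) (fun σ hσ => ?_) hW
    simp only [LinearMap.comp_apply, firstVertex, Finsupp.lmapDomain_apply,
      Finsupp.mapDomain_single, constChain_single]
    exact single_mem_supported fun t => hσ _
  · conv_rhs => rw [← hg]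
    refine linearMap_eq_of_single (f := push g m ∘ₗ constChain X m ∘ₗ firstVertex X n)
      (g := constChain X m ∘ₗ firstVertex X n ∘ₗ push g (n + 1)) (fun σ => ?_) c
    simp [firstVertex]

/-- An invariant cycle of positive dimension made of constant simplices bounds invariantly. -/
theorem exists_bdry_of_const {n : ℕ} {c : Chain X (n + 2)}
    (hc : c ∈ Finsupp.supported ℤ ℤ {σ : C(Splx (n + 2), X) | ∀ s t, σ s = σ t})
    (g : C(X, X)) (hg : push g (n + 2) c = c) {W : Set X} (hW : c ∈ chainsIn W (n + 2))
    (hb : bdry X (n + 1) c = 0) :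
    ∃ b ∈ chainsIn W (n + 3), push g (n + 3) b = b ∧ bdry X (n + 2) b = c := by
  obtain ⟨h1, -, -⟩ := constChain_firstVertex hc 0 g hg hW
  obtain ⟨-, h2, h3⟩ := constChain_firstVertex hc (n + 3) g hg hW
  refine ⟨_, h2, h3, ?_⟩
  rw [bdry_constChain]
  -- In the even case the constant chain one dimension up has boundary `c`. In the odd case the
  -- cycle condition on `c` already forces `c = 0`.
  split_ifs with hn
  · exact h1
  · rw [← h1, bdry_constChain, if_pos (by
      rwa [Nat.even_add_one, not_not] at hn)] at hb
    have h4 := congrArg (firstVertex X n) hb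
    rw [firstVertex_constChain, map_zero] at h4
    rw [← h1, h4, map_zero]

/-! ### Contractions -/

/-- The inclusion of a subset. -/
def incl (W : Set X) : C(W, X) := ⟨Subtype.val, continuous_subtype_val⟩

theorem exists_push_incl {W : Set X} {n : ℕ} {c : Chain X n} (hc : c ∈ chainsIn W n) :
    ∃ c' : Chain W n, push (incl W) n c' = c :=
  map_mem_of_supported (s := {σ : C(Splx n, X) | ∀ t, σ t ∈ W}) (L := LinearMap.id)
    (p := LinearMap.range (push (incl W) n)) (fun σ hσ => ⟨Finsupp.single ⟨fun t => ⟨σ t, hσ t⟩, σ.continuous.subtype_mk _⟩ 1, by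
      rw [push_single]; rfl⟩) hc

theorem push_incl_injective (W : Set X) (n : ℕ) : Function.Injective (push (incl W) n) :=
  Finsupp.mapDomain_injective fun _ _ h =>
    ContinuousMap.ext fun t => Subtype.ext (DFunLike.congr_fun h t)

theorem bdry_eq_zero_of_push_incl {W : Set X} {n : ℕ} {c : Chain W (n + 1)}
    (h : bdry X n (push (incl W) (n + 1) c) = 0) : bdry W n c = 0 :=
  push_incl_injective W n (by rw [← bdry_push, h, map_zero])

/-- The prism over an equivariant homotopy makes `c` homologous, through an invariant chain, to its
image under a locally constant map. That image consists of constant simplices because simplices are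
connected. A locally constant end is required since `g` may permute the pieces of `W`, so that no
single point can serve as an equivariant target. -/
theorem InvariantlyBounds.of_contraction {g : C(X, X)} {W : Set X} (hg : Set.MapsTo g W W)
    (h : C(W × unitInterval, X)) (hW : ∀ p, h p ∈ W) (h0 : ∀ x : W, h (x, 0) = x)
    (h1 : IsLocallyConstant fun x : W => h (x, 1))
    (hgh : ∀ (x : W) t, h (⟨g x, hg x.2⟩, t) = g (h (x, t))) : InvariantlyBounds g W 1 := by
  intro n hn c hc hgc hbc
  obtain ⟨n, rfl⟩ := Nat.exists_eq_succ_of_ne_zero (by omega : n ≠ 0)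
  obtain ⟨c, rfl⟩ := exists_push_incl hc
  have hb := bdry_eq_zero_of_push_incl hbc
  let gW : C(W, W) := ⟨fun x => ⟨g x, hg x.2⟩,
    (g.continuous.comp continuous_subtype_val).subtype_mk _⟩
  have hcg : push gW (n + 2) c = c := by
    refine push_incl_injective W _ ?_
    rw [push_push]
    rw [push_push] at hgc
    exact hgc
  have e0 : h.comp (atHeight W 0) = incl W := ContinuousMap.ext h0
  have e1 : g.comp (h.comp (atHeight W 1)) = (h.comp (atHeight W 1)).comp gW :=
    ContinuousMap.ext fun x => (hgh x 1).symm
  have eg : g.comp h = h.comp (gW.prodMap (ContinuousMap.id _)) :=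
    ContinuousMap.ext fun x => (hgh x.1 x.2).symm
  have hbd := bdry_push_prism h c
  rw [hb, map_zero, map_zero, sub_zero, e0] at hbd
  obtain ⟨b, hbW, hgb, hbb⟩ := exists_bdry_of_const (n := n)
    (c := push (h.comp (atHeight W 1)) (n + 2) c) (W := W) (g := g)
    (map_mem_of_supported (s := Set.univ) (fun σ _ => by
      rw [push_single]
      refine single_mem_supported fun s t => ?_
      exact (h1.comp_continuous σ.continuous).apply_eq_of_isPreconnected
        isPreconnected_univ (Set.mem_univ s) (Set.mem_univ t))
      ((Finsupp.mem_supported ℤ c).2 (Set.subset_univ _)))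
    (by rw [push_push, e1, ← push_push, hcg])
    (push_mem_chainsIn (W := Set.univ) (fun x _ => hW (x, 1)) (mem_chainsIn_univ c))
    (by rw [bdry_push, hb, map_zero])
  refine ⟨b - push h (n + 3) (prism W (n + 2) c), Submodule.sub_mem _ hbW
    (push_mem_chainsIn (W := Set.univ) (fun x _ => hW _) (mem_chainsIn_univ _)), ?_, ?_⟩
  · rw [map_sub, hgb, push_push, eg, ← push_push, push_prism, hcg]
  · rw [map_sub, hbb, hbd]
    abel

theorem exists_push_const (p : Y) {n : ℕ} (c : Chain X n) :
    ∃ k : ℤ, push (ContinuousMap.const X p) n c = constChain Y n (Finsupp.single p k) := by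
  induction c using Finsupp.induction_linear with
  | zero => exact ⟨0, by simp⟩
  | add a b ha hb =>
    obtain ⟨k, hk⟩ := ha
    obtain ⟨l, hl⟩ := hb
    exact ⟨k + l, by rw [map_add, hk, hl, Finsupp.single_add, map_add]⟩
  | single σ k => exact ⟨k, by simp⟩

/-- The image is `k` times one constant simplex. It is the boundary of the constant simplex one
dimension up, or else the parity is such that being a cycle forces `k = 0`. -/
theorem exists_bdry_of_push_const (p : Y) {n : ℕ} {c : Chain X n} (hc : IsCycle c) {W : Set Y}
    (hp : p ∈ W) :
    ∃ b ∈ chainsIn W (n + 1), bdry Y n b = push (ContinuousMap.const X p) n c := by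
  obtain ⟨k, hk⟩ := exists_push_const p c
  refine ⟨constChain Y (n + 1) (Finsupp.single p k), ?_, ?_⟩
  · rw [constChain_single, ← mul_one k, ← smul_eq_mul, ← Finsupp.smul_single]
    exact Submodule.smul_mem _ _ (single_mem_supported fun _ => hp)
  rw [bdry_constChain, hk]
  split_ifs with hn
  · rfl
  · cases n with
    | zero => simp at hn
    | succ n =>
      have h : bdry Y n (push (ContinuousMap.const X p) (n + 1) c) = 0 := by
        rw [bdry_push]
        exact (congrArg _ hc).trans (map_zero _)
      rw [hk, bdry_constChain, if_pos (by rwa [Nat.even_add_one, not_not] at hn),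
        constChain_single, Finsupp.single_eq_zero] at h
      rw [h, Finsupp.single_zero, map_zero]

theorem Acyclic.of_contraction {W : Set X} {p : X} (hp : p ∈ W) (h : C(W × unitInterval, X))
    (hW : ∀ q, h q ∈ W) (h0 : ∀ x : W, h (x, 0) = x) (h1 : ∀ x : W, h (x, 1) = p) : Acyclic W := by
  intro n c hc hcc
  obtain ⟨c, rfl⟩ := exists_push_incl hc
  have e0 : h.comp (atHeight W 0) = incl W := ContinuousMap.ext h0
  have e1 : h.comp (atHeight W 1) = ContinuousMap.const W p := ContinuousMap.ext h1
  cases n with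
  | zero =>
    obtain ⟨b, hb, hbb⟩ := exists_bdry_of_push_const p (c := c) trivial hp
    refine ⟨b, hb, hbb.trans ?_⟩
    -- In augmented degree zero there is only the empty simplex, on which the constant map and the
    -- inclusion agree.
    refine linearMap_eq_of_single (f := push (ContinuousMap.const W p) 0)
      (g := push (incl W) 0) (fun σ => ?_) c
    rw [push_single, push_single]
    congr 1
    exact ContinuousMap.ext fun t => by simpa using stdSimplex.sum_eq_one t
  | succ n =>
    have hb : bdry W n c = 0 := bdry_eq_zero_of_push_incl hcc
    obtain ⟨b, hbW, hbb⟩ := exists_bdry_of_push_const p (c := c) hb hp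
    have hbd := bdry_push_prism h c
    rw [hb, map_zero, map_zero, sub_zero, e0, e1] at hbd
    refine ⟨b - push h (n + 2) (prism W (n + 1) c), Submodule.sub_mem _ hbW
      (push_mem_chainsIn (W := Set.univ) (fun x _ => hW _) (mem_chainsIn_univ _)), ?_⟩
    rw [map_sub, hbb, hbd]
    abel

/-! ### Free actions of the group of order three -/

/-- `R` picks one representative from each orbit. Freeness makes the three alternatives describe
genuinely different points, so identities between coefficients can be checked case by case. -/
theorem exists_orbit_section {B : Type*} {τ : B → B} (h3 : ∀ b, τ (τ (τ b)) = b)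
    (hfree : ∀ b, τ b ≠ b) :
    ∃ R : Set B, ∀ b, (b ∈ R ∧ τ b ∉ R ∧ τ (τ b) ∉ R) ∨ (b ∉ R ∧ τ b ∈ R ∧ τ (τ b) ∉ R) ∨
      (b ∉ R ∧ τ b ∉ R ∧ τ (τ b) ∈ R) := by
  let s : Setoid B :=
    { r := fun b c => c = b ∨ c = τ b ∨ c = τ (τ b)
      iseqv := ⟨fun _ => .inl rfl, by rintro b _ (rfl | rfl | rfl) <;> simp [h3], by
        rintro a _ _ (rfl | rfl | rfl) (rfl | rfl | rfl) <;> simp [h3]⟩ }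
  have hτ (b : B) : (⟦τ b⟧ : Quotient s) = ⟦b⟧ := Quotient.sound (by
    change b = τ b ∨ b = τ (τ b) ∨ b = τ (τ (τ b)); simp [h3])
  have hfree2 (b : B) : τ (τ b) ≠ b := fun h =>
    hfree b ((congrArg τ h).symm.trans (h3 b))
  refine ⟨{b | (⟦b⟧ : Quotient s).out = b}, fun b => ?_⟩
  have hout : ((⟦b⟧ : Quotient s).out = b ∨ (⟦b⟧ : Quotient s).out = τ b ∨
      (⟦b⟧ : Quotient s).out = τ (τ b)) := by
    have h : (⟦b⟧ : Quotient s) = ⟦(⟦b⟧ : Quotient s).out⟧ := (Quotient.out_eq _).symm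
    exact Quotient.exact h
  simp only [Set.mem_ofPred_eq, hτ]
  rcases hout with h | h | h <;> rw [h]
  · simp [(hfree b).symm, (hfree2 b).symm]
  · simp [hfree b, (hfree (τ b)).symm]
  · simp [hfree2 b, hfree (τ b)]

section FreeAction

variable {B : Type*} {τ : B → B}

theorem mapDomain_apply_of_cube (h3 : ∀ b, τ (τ (τ b)) = b) (x : B →₀ ℤ) (b : B) :
    Finsupp.mapDomain τ x b = x (τ (τ b)) := by
  have hinj : Function.Injective τ := fun a b h => by rw [← h3 a, h, h3]
  conv_lhs => rw [← h3 b]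
  exact Finsupp.mapDomain_apply hinj x _

/-- A coefficient function constant on free orbits is the norm of its restriction to a set of
representatives. -/
theorem exists_norm_eq (h3 : ∀ b, τ (τ (τ b)) = b) (hfree : ∀ b, τ b ≠ b) {x : B →₀ ℤ}
    (hx : Finsupp.mapDomain τ x = x) :
    ∃ e : B →₀ ℤ, x = e + Finsupp.mapDomain τ e +
      Finsupp.mapDomain τ (Finsupp.mapDomain τ e) := by
  classical
  obtain ⟨R, hR⟩ := exists_orbit_section h3 hfree
  have h2 (b : B) : x (τ (τ b)) = x b := by rw [← mapDomain_apply_of_cube h3, hx]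
  have h1 (b : B) : x (τ b) = x b := by rw [← h2 b, ← h2 (τ b), h3]; exact (h2 b).symm ▸ rfl
  refine ⟨x.filter (· ∈ R), Finsupp.ext fun b => ?_⟩
  simp only [Finsupp.add_apply, mapDomain_apply_of_cube h3, h3, Finsupp.filter_apply]
  rcases hR b with ⟨r0, r1, r2⟩ | ⟨r0, r1, r2⟩ | ⟨r0, r1, r2⟩ <;> simp [r0, r1, r2, h1]

theorem exists_sub_map_eq (h3 : ∀ b, τ (τ (τ b)) = b) (hfree : ∀ b, τ b ≠ b) {x : B →₀ ℤ}
    (hx : x + Finsupp.mapDomain τ x + Finsupp.mapDomain τ (Finsupp.mapDomain τ x) = 0) :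
    ∃ y : B →₀ ℤ, x = y - Finsupp.mapDomain τ y := by
  classical
  obtain ⟨R, hR⟩ := exists_orbit_section h3 hfree
  have h (b : B) : x b + x (τ (τ b)) + x (τ b) = 0 := by
    have := DFunLike.congr_fun hx b
    simpa only [Finsupp.add_apply, mapDomain_apply_of_cube h3, h3, Finsupp.zero_apply] using this
  -- The witness consists of partial sums along each orbit: for `b ∈ R` it takes the values `x b`,
  -- `x b + x (τ b)` and `0` at `b`, `τ b` and `τ (τ b)`. The vanishing norm closes the cycle.
  refine ⟨x.filter (· ∈ R) + (x + Finsupp.mapDomain τ x).filter (fun b => τ (τ b) ∈ R),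
    Finsupp.ext fun b => ?_⟩
  have hb := h b
  simp only [Finsupp.sub_apply, Finsupp.add_apply, mapDomain_apply_of_cube h3, h3,
    Finsupp.filter_apply]
  rcases hR b with ⟨r0, r1, r2⟩ | ⟨r0, r1, r2⟩ | ⟨r0, r1, r2⟩ <;> simp [r0, r1, r2]
  linarith

end FreeAction

end SingularChain

namespace ThreeSphere

open SingularChain

/-! ### Conical subsets of the sphere -/

/-- The ambient space of the sphere. -/
abbrev Ambient : Type := EuclideanSpace ℂ (Fin 2)

theorem norm_coe (x : ThreeSphere) : ‖(x : Ambient)‖ = 1 := by simp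

/-- Radial projection of a nowhere vanishing map to the sphere. -/
noncomputable def normalize {T : Type*} [TopologicalSpace T] (k : C(T, Ambient))
    (hk : ∀ t, k t ≠ 0) : C(T, ThreeSphere) where
  toFun t := ⟨(‖k t‖⁻¹ : ℝ) • k t, by
    rw [mem_sphere_zero_iff_norm, norm_smul, norm_inv, norm_norm,
      inv_mul_cancel₀ (norm_ne_zero_iff.2 (hk t))]⟩
  continuous_toFun := Continuous.subtype_mk
    ((k.continuous.norm.inv₀ fun t => norm_ne_zero_iff.2 (hk t)).smul k.continuous) _

theorem coe_normalize {T : Type*} [TopologicalSpace T] (k : C(T, Ambient)) (hk : ∀ t, k t ≠ 0)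
    (t : T) : (normalize k hk t : Ambient) = (‖k t‖⁻¹ : ℝ) • k t := rfl

theorem normalize_eq {T : Type*} [TopologicalSpace T] (k : C(T, Ambient)) (hk : ∀ t, k t ≠ 0)
    {t : T} {x : ThreeSphere} (h : k t = x) : normalize k hk t = x :=
  Subtype.ext (by rw [coe_normalize, h, norm_coe, inv_one, one_smul])

/-- A set stable under positive scalars and avoiding the origin. -/
structure IsCone (K : Set Ambient) : Prop where
  smul_mem : ∀ (r : ℝ), 0 < r → ∀ v ∈ K, r • v ∈ K
  zero_notMem : (0 : Ambient) ∉ K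

/-- The part of a set on the sphere. -/
def onSphere (K : Set Ambient) : Set ThreeSphere := {x | (x : Ambient) ∈ K}

theorem isOpen_onSphere {K : Set Ambient} (hK : IsOpen K) : IsOpen (onSphere K) :=
  hK.preimage continuous_subtype_val

theorem IsCone.normalize_mem {K : Set Ambient} (hK : IsCone K) {T : Type*} [TopologicalSpace T]
    (k : C(T, Ambient)) (hk : ∀ t, k t ≠ 0) {t : T} (h : k t ∈ K) :
    normalize k hk t ∈ onSphere K :=
  hK.smul_mem _ (inv_pos.2 (norm_pos_iff.2 (hk t))) _ h

/-- The straight-line homotopy to a map `c`. -/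
noncomputable def lineTo {K : Set Ambient} (c : C(onSphere K, Ambient)) :
    C(onSphere K × unitInterval, Ambient) where
  toFun p := (1 - (p.2 : ℝ)) • ((p.1 : ThreeSphere) : Ambient) + (p.2 : ℝ) • c p.1
  continuous_toFun := by fun_prop

theorem lineTo_ne_zero {K : Set Ambient} (hK : IsCone K) {c : C(onSphere K, Ambient)}
    (hc : ∀ p, lineTo c p ∈ K) (p) : lineTo c p ≠ 0 :=
  fun h => hK.zero_notMem (h ▸ hc p)

/-- The segments to `p` stay in the cone, hence avoid the origin, and radial projection turns them
into a contraction inside the sphere. -/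
theorem acyclic_onSphere {K : Set Ambient} (hK : IsCone K) {p : ThreeSphere}
    (hp : (p : Ambient) ∈ K)
    (hseg : ∀ v ∈ K, ∀ t : ℝ, 0 ≤ t → t ≤ 1 → (1 - t) • v + t • (p : Ambient) ∈ K) :
    Acyclic (onSphere K) := by
  have hc (q) : lineTo (ContinuousMap.const (onSphere K) (p : Ambient)) q ∈ K :=
    hseg _ q.1.2 _ q.2.2.1 q.2.2.2
  refine Acyclic.of_contraction (p := p) hp (normalize _ (lineTo_ne_zero hK hc))
    (fun q => hK.normalize_mem _ _ (hc q)) (fun x => normalize_eq _ _ ?_)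
    (fun x => normalize_eq _ _ ?_) <;> simp [lineTo]

/-! ### The third homology of the sphere -/

/-- The real coordinates. -/
def coord (i : Fin 4) (v : Ambient) : ℝ := ![(v 0).re, (v 0).im, (v 1).re, (v 1).im] i

theorem coord_add (i : Fin 4) (v w : Ambient) : coord i (v + w) = coord i v + coord i w := by
  fin_cases i <;> simp [coord]

theorem coord_smul (i : Fin 4) (r : ℝ) (v : Ambient) : coord i (r • v) = r * coord i v := by
  fin_cases i <;> simp [coord]

theorem continuous_coord (i : Fin 4) : Continuous (coord i) := by
  have h : coord i = fun v => ![(v 0).re, (v 0).im, (v 1).re, (v 1).im] i := rfl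
  rw [h]
  fin_cases i <;> dsimp <;> fun_prop

theorem eq_zero_of_coord {v : Ambient} (h : ∀ i, coord i v = 0) : v = 0 := by
  ext i
  fin_cases i
  · exact Complex.ext (h 0) (h 1)
  · exact Complex.ext (h 2) (h 3)

theorem exists_coord (j : Fin 4) (s : ℝ) (hs : |s| = 1) :
    ∃ p : ThreeSphere, ∀ i, coord i p = if i = j then s else 0 := by
  have hs' : ‖s‖ = 1 := hs
  have h1 (a b : ℂ) (h : ‖a‖ ^ 2 + ‖b‖ ^ 2 = 1) :
      (!₂[a, b] : Ambient) ∈ Metric.sphere (0 : Ambient) 1 := by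
    rw [mem_sphere_zero_iff_norm, EuclideanSpace.norm_eq]
    simp [h]
  fin_cases j
  · exact ⟨⟨!₂[(s : ℂ), 0], h1 _ _ (by simp [hs])⟩, fun i => by fin_cases i <;> simp [coord]⟩
  · exact ⟨⟨!₂[s * Complex.I, 0], h1 _ _ (by simp [hs])⟩,
      fun i => by fin_cases i <;> simp [coord]⟩
  · exact ⟨⟨!₂[0, (s : ℂ)], h1 _ _ (by simp [hs])⟩, fun i => by fin_cases i <;> simp [coord]⟩
  · exact ⟨⟨!₂[0, s * Complex.I], h1 _ _ (by simp [hs])⟩,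
      fun i => by fin_cases i <;> simp [coord]⟩

/-- The complement of a half-space of a coordinate subspace. -/
def slit (j : Fin 4) (s : ℝ) : Set Ambient := {v | 0 < s * coord j v ∨ ∃ i, j < i ∧ coord i v ≠ 0}

theorem isOpen_slit (j : Fin 4) (s : ℝ) : IsOpen (slit j s) := by
  have : {v : Ambient | ∃ i, j < i ∧ coord i v ≠ 0} =
      ⋃ i, ⋃ _ : j < i, {v | coord i v ≠ 0} := by ext; simp
  rw [slit, Set.ofPred_or, this]
  refine (isOpen_lt continuous_const (continuous_const.mul (continuous_coord j))).union ?_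
  exact isOpen_iUnion fun i => isOpen_iUnion fun _ =>
    isOpen_ne_fun (continuous_coord i) continuous_const

theorem isCone_slit (j : Fin 4) (s : ℝ) : IsCone (slit j s) where
  smul_mem r hr v hv := by
    rcases hv with h | ⟨i, hi, h⟩
    · left
      rw [coord_smul, mul_left_comm]
      exact mul_pos hr h
    · exact .inr ⟨i, hi, by rw [coord_smul]; exact mul_ne_zero hr.ne' h⟩
  zero_notMem h := by
    have h0 (i : Fin 4) : coord i 0 = 0 := by simpa using coord_smul i 0 0
    rcases h with h | ⟨i, -, h⟩
    · simp [h0] at h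
    · exact h (h0 i)

/-- The slit space is star-shaped about the signed coordinate vector `s e_j`: along the segment the
coordinates beyond `j` are only rescaled, and `s` times the `j`-th coordinate ends at 1. -/
theorem acyclic_slit (j : Fin 4) (s : ℝ) (hs : |s| = 1) : Acyclic (onSphere (slit j s)) := by
  obtain ⟨p, hp⟩ := exists_coord j s hs
  have hss : s * s = 1 := by rw [← abs_mul_abs_self, hs, one_mul]
  refine acyclic_onSphere (isCone_slit j s) (p := p) (.inl (by simp [hp, hss])) ?_
  intro v hv t ht0 ht1
  rcases hv with h | ⟨i, hi, h⟩
  · left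
    have h2 : s * coord j ((1 - t) • v + t • (p : Ambient)) = (1 - t) * (s * coord j v) + t := by
      rw [coord_add, coord_smul, coord_smul, hp, if_pos rfl]
      linear_combination t * hss
    rw [h2]
    rcases ht0.eq_or_lt with rfl | ht
    · simpa using h
    · nlinarith
  · rcases ht1.eq_or_lt with rfl | ht
    · left
      simp [hp, hss]
    · refine .inr ⟨i, hi, ?_⟩
      rw [coord_add, coord_smul, coord_smul, hp, if_neg hi.ne', mul_zero, add_zero]
      exact mul_ne_zero (by linarith) h

theorem slit_union (j : Fin 4) :
    onSphere (slit j 1) ∪ onSphere (slit j (-1)) = onSphere {v | ∃ i, j ≤ i ∧ coord i v ≠ 0} := by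
  ext x
  constructor
  · rintro ((h | ⟨i, hi, h⟩) | (h | ⟨i, hi, h⟩))
    · exact ⟨j, le_rfl, fun h0 => by simp [h0] at h⟩
    · exact ⟨i, hi.le, h⟩
    · exact ⟨j, le_rfl, fun h0 => by simp [h0] at h⟩
    · exact ⟨i, hi.le, h⟩
  · rintro ⟨i, hi, h⟩
    rcases hi.eq_or_lt with rfl | hi
    · rcases h.lt_or_gt with h | h
      · exact .inr (.inl (by linarith))
      · exact .inl (.inl (by linarith))
    · exact .inl (.inr ⟨i, hi, h⟩)

theorem slit_inter (j : Fin 4) :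
    onSphere (slit j 1) ∩ onSphere (slit j (-1)) = onSphere {v | ∃ i, j < i ∧ coord i v ≠ 0} := by
  ext x
  constructor
  · rintro ⟨h | h, h' | h'⟩
    · linarith
    all_goals first | exact h | exact h'
  · exact fun h => ⟨.inr h, .inr h⟩

/-- The points having a nonzero coordinate of index at least `j` form a set with the homotopy type
of a sphere of dimension `3 - j`. Two slit spaces cover it and meet in the next smaller such set, so
four suspension steps lead from the empty set at index 0 to the whole sphere at index 4. -/
theorem infiniteCyclic_univ : InfiniteCyclic (Set.univ : Set ThreeSphere) 4 := by
  have step (j : Fin 4) (n : ℕ)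
      (h : InfiniteCyclic (onSphere {v | ∃ i, j < i ∧ coord i v ≠ 0}) n) :
      InfiniteCyclic (onSphere {v | ∃ i, j ≤ i ∧ coord i v ≠ 0}) (n + 1) := by
    rw [← slit_union]
    refine InfiniteCyclic.union (isOpen_onSphere (isOpen_slit _ _))
      (isOpen_onSphere (isOpen_slit _ _)) (acyclic_slit _ _ (by simp)) (acyclic_slit _ _ (by simp))
      ?_
    rwa [slit_inter]
  have h4 : onSphere {v | ∃ i : Fin 4, 3 < i ∧ coord i v ≠ 0} = ∅ := by
    rw [Set.eq_empty_iff_forall_notMem]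
    rintro x ⟨i, hi, -⟩
    exact absurd hi (not_lt.2 (Fin.le_last i))
  have hlt (j k : Fin 4) (hjk : ∀ i, j < i ↔ k ≤ i) :
      onSphere {v | ∃ i, j < i ∧ coord i v ≠ 0} = onSphere {v | ∃ i, k ≤ i ∧ coord i v ≠ 0} := by
    simp only [hjk]
  have h0 : onSphere {v | ∃ i : Fin 4, 0 ≤ i ∧ coord i v ≠ 0} = Set.univ := by
    refine Set.eq_univ_of_forall fun x => ?_
    by_contra h
    have hx : (x : Ambient) = 0 := eq_zero_of_coord fun i => by
      by_contra hi
      exact h ⟨i, Fin.zero_le i, hi⟩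
    have := norm_coe x
    rw [hx, norm_zero] at this
    exact zero_ne_one this
  rw [← h0]
  refine step 0 3 ?_
  rw [hlt 0 1 (by decide)]
  refine step 1 2 ?_
  rw [hlt 1 2 (by decide)]
  refine step 2 1 ?_
  rw [hlt 2 3 (by decide)]
  refine step 3 0 ?_
  rw [h4]
  exact infiniteCyclic_empty

end ThreeSphere

namespace ThreeSphere

open SingularChain

/-! ### The rotation of order three -/

/-- The primitive cube root of unity. -/
noncomputable def omega : ℂ := ⟨-1 / 2, √3 / 2⟩

theorem omega_sq : omega ^ 2 = ⟨-1 / 2, -(√3 / 2)⟩ := by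
  have h : √3 * √3 = 3 := Real.mul_self_sqrt (by norm_num)
  rw [sq, omega]
  apply Complex.ext
  · simp only [Complex.mul_re]; linarith
  · simp only [Complex.mul_im]; ring

theorem omega_add : 1 + omega + omega ^ 2 = 0 := by
  rw [omega_sq, omega]
  apply Complex.ext
  · simp only [Complex.add_re, Complex.one_re, Complex.zero_re]; norm_num
  · simp

theorem omega_cube : omega ^ 3 = 1 := by
  linear_combination (omega - 1) * omega_add

theorem omega_ne_one : omega ≠ 1 := fun h => by
  have := congrArg Complex.re h
  norm_num [omega] at this

/-- The primitive cube root of unity as an element of `μ₃`. -/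
noncomputable def zeta : rootsOfUnity 3 ℂ := rootsOfUnity.mkOfPowEq omega omega_cube

/-- The action of the primitive cube root of unity. -/
noncomputable def rot : C(ThreeSphere, ThreeSphere) where
  toFun x := zeta • x
  continuous_toFun := continuous_induced_rng.2
    (continuous_subtype_val.const_smul ((zeta : ℂˣ) : ℂ))

theorem coe_rot (x : ThreeSphere) : (rot x : Ambient) = omega • (x : Ambient) := by
  change ((zeta • x : ThreeSphere) : Ambient) = _
  rw [coe_smul, zeta, rootsOfUnity.val_mkOfPowEq_coe]

theorem rot_rot_rot (x : ThreeSphere) : rot (rot (rot x)) = x := by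
  apply Subtype.ext
  rw [coe_rot, coe_rot, coe_rot, smul_smul, smul_smul]
  have := omega_cube
  rw [show omega * omega * omega = 1 by rw [← this]; ring, one_smul]

theorem rot_ne (x : ThreeSphere) : rot x ≠ x := by
  intro h
  have h1 : (omega - 1) • (x : Ambient) = 0 := by
    rw [sub_smul, one_smul, ← coe_rot, h, sub_self]
  rcases smul_eq_zero.1 h1 with h | h
  · exact omega_ne_one (sub_eq_zero.1 h)
  · have := norm_coe x
    rw [h, norm_zero] at this
    exact zero_ne_one this

/-! ### Families of sectors -/

/-- A family of disjoint open sectors of `ℂ`, each with a center, permuted by the rotation of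
order three. -/
structure SectorFamily (J : Type) where
  /-- The sectors. -/
  sector : J → Set ℂ
  /-- The centers. -/
  center : J → ℂ
  /-- The permutation of the sectors. -/
  next : J → J
  isOpen : ∀ j, IsOpen (sector j)
  eq_of_mem : ∀ {i j α}, α ∈ sector i → α ∈ sector j → i = j
  smul_mem : ∀ {j α} (r : ℝ), 0 < r → α ∈ sector j → r * α ∈ sector j
  segment_mem : ∀ {j α} (t : ℝ), 0 ≤ t → t ≤ 1 → α ∈ sector j →
    (1 - t) * α + t * center j ∈ sector j
  omega_mul_mem : ∀ {j α}, α ∈ sector j → omega * α ∈ sector (next j)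
  center_next : ∀ j, center (next j) = omega * center j

namespace SectorFamily

variable {J J' : Type}

/-- The union of the sectors of a family. -/
def carrier (F : SectorFamily J) : Set ℂ := {α | ∃ j, α ∈ F.sector j}

theorem isOpen_carrier (F : SectorFamily J) : IsOpen F.carrier := by
  have : F.carrier = ⋃ j, F.sector j := by ext; simp [carrier]
  rw [this]
  exact isOpen_iUnion F.isOpen

theorem omega_mul_mem_carrier (F : SectorFamily J) {α : ℂ} (h : α ∈ F.carrier) :
    omega * α ∈ F.carrier := by
  obtain ⟨j, hj⟩ := h
  exact ⟨_, F.omega_mul_mem hj⟩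

/-- The whole plane as one sector. -/
def whole : SectorFamily Unit where
  sector _ := Set.univ
  center _ := 0
  next := id
  isOpen _ := isOpen_univ
  eq_of_mem _ _ := rfl
  smul_mem _ _ _ := trivial
  segment_mem _ _ _ _ := trivial
  omega_mul_mem _ := trivial
  center_next _ := (mul_zero _).symm

/-- The opposite family. -/
def neg (F : SectorFamily J) : SectorFamily J where
  sector j := {α | -α ∈ F.sector j}
  center j := -F.center j
  next := F.next
  isOpen j := (F.isOpen j).preimage continuous_neg
  eq_of_mem h h' := F.eq_of_mem h h'
  smul_mem r hr h := by
    have := F.smul_mem r hr h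
    rwa [mul_neg] at this
  segment_mem t h0 h1 h := by
    have := F.segment_mem t h0 h1 h
    change -((1 - t : ℂ) * _ + t * -F.center _) ∈ F.sector _
    convert this using 1
    ring
  omega_mul_mem h := by
    have := F.omega_mul_mem h
    rwa [mul_neg] at this
  center_next j := by rw [F.center_next, mul_neg]

/-- The imaginary part of the `k`-th rotation of a number. -/
noncomputable def func (k : Fin 3) (α : ℂ) : ℝ := (![1, omega, omega ^ 2] k * α).im

theorem func_add (k : Fin 3) (α β : ℂ) : func k (α + β) = func k α + func k β := by
  simp [func, mul_add]

theorem func_real_mul (k : Fin 3) (r : ℝ) (α : ℂ) : func k (r * α) = r * func k α := by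
  rw [func, func, mul_left_comm, Complex.im_ofReal_mul]

theorem func_neg (k : Fin 3) (α : ℂ) : func k (-α) = -func k α := by
  simp [func]

theorem func_omega_mul (k : Fin 3) (α : ℂ) : func k (omega * α) = func (k + 1) α := by
  have h : ![1, omega, omega ^ 2] k * omega = ![1, omega, omega ^ 2] (k + 1) := by
    fin_cases k
    · simp
    · simp [sq]
    · simpa [pow_succ] using omega_cube
  rw [func, func, ← h, mul_assoc]

theorem continuous_func (k : Fin 3) : Continuous (func k) :=
  Complex.continuous_im.comp (continuous_const.mul continuous_id)

theorem func_zero_add (α : ℂ) : func 0 α + func 1 α + func 2 α = 0 := by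
  have h : func 0 α + func 1 α + func 2 α = ((1 + omega + omega ^ 2) * α).im := by
    simp [func, add_mul]
  rw [h, omega_add, zero_mul, Complex.zero_im]

theorem func_one (k : Fin 3) : func k 1 = ![0, √3 / 2, -(√3 / 2)] k := by
  fin_cases k
  · simp [func]
  · simp [func, omega]
  · simp [func, omega_sq]

/-- The centers of the basic sectors. -/
noncomputable def baseCenter (k : Fin 3) : ℂ := ![1, omega ^ 2, omega] k

theorem func_baseCenter (j k : Fin 3) :
    func j (baseCenter k) = ![0, √3 / 2, -(√3 / 2)] (j - k) := by
  have h1 : baseCenter 2 = omega * 1 := by simp [baseCenter]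
  have h2 : baseCenter 1 = omega * (omega * 1) := by simp [baseCenter, sq]
  rw [← func_one]
  fin_cases k
  · change func j 1 = func (j - 0) 1
    rw [sub_zero]
  · change func j (baseCenter 1) = func (j - 1) 1
    rw [h2, func_omega_mul, func_omega_mul]
    congr 1
    fin_cases j <;> rfl
  · change func j (baseCenter 2) = func (j - 2) 1
    rw [h1, func_omega_mul]
    congr 1
    fin_cases j <;> rfl

theorem func_segment (j : Fin 3) (t : ℝ) (α β : ℂ) :
    func j ((1 - t) * α + t * β) = (1 - t) * func j α + t * func j β := by
  rw [func_add, func_real_mul, ← func_real_mul j (1 - t)]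
  push_cast
  rfl

theorem segment_pos {a b t : ℝ} (h0 : 0 ≤ t) (h1 : t ≤ 1) (ha : 0 < a) (hb : 0 < b) :
    0 < (1 - t) * a + t * b := by
  rcases h0.eq_or_lt with rfl | h
  · simpa using ha
  · exact add_pos_of_nonneg_of_pos (mul_nonneg (by linarith) ha.le) (mul_pos h hb)

theorem segment_neg {a b t : ℝ} (h0 : 0 ≤ t) (h1 : t ≤ 1) (ha : a < 0) (hb : b < 0) :
    (1 - t) * a + t * b < 0 := by
  have := segment_pos h0 h1 (neg_pos.2 ha) (neg_pos.2 hb)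
  linarith

/-- Three sectors of angle `2π / 3` centered at the cube roots of unity. -/
noncomputable def base : SectorFamily (Fin 3) where
  sector k := {α | 0 < func (k + 1) α ∧ func (k + 2) α < 0}
  center := baseCenter
  next k := k + 2
  isOpen k := (isOpen_lt continuous_const (continuous_func _)).inter
    (isOpen_lt (continuous_func _) continuous_const)
  eq_of_mem {i j α} hi hj := by
    obtain ⟨h1, h2⟩ := hi
    obtain ⟨h3, h4⟩ := hj
    fin_cases i <;> fin_cases j <;> first | rfl | skip
    all_goals
      first
      | exact absurd (lt_trans h1 h4) (lt_irrefl _)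
      | exact absurd (lt_trans h3 h2) (lt_irrefl _)
  smul_mem {j α} r hr h := by
    refine ⟨?_, ?_⟩
    · rw [func_real_mul]; exact mul_pos hr h.1
    · rw [func_real_mul]; exact mul_neg_of_pos_of_neg hr h.2
  segment_mem {j α} t h0 h1 h := by
    have e1 : j + 1 - j = 1 := by fin_cases j <;> rfl
    have e2 : j + 2 - j = 2 := by fin_cases j <;> rfl
    refine ⟨?_, ?_⟩
    · rw [func_segment]
      exact segment_pos h0 h1 h.1 (by rw [func_baseCenter, e1]; simp)
    · rw [func_segment]
      exact segment_neg h0 h1 h.2 (by rw [func_baseCenter, e2]; simp)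
  omega_mul_mem {j α} h := by
    have e1 : j + 2 + 1 + 1 = j + 1 := by fin_cases j <;> rfl
    have e2 : j + 2 + 2 + 1 = j + 2 := by fin_cases j <;> rfl
    refine ⟨?_, ?_⟩
    · rw [func_omega_mul, e1]; exact h.1
    · rw [func_omega_mul, e2]; exact h.2
  center_next j := by
    fin_cases j
    · simp [baseCenter]
    · change (1 : ℂ) = omega * omega ^ 2
      rw [← omega_cube]; ring
    · change omega ^ 2 = omega * omega
      ring

/-- Six sectors of angle `π / 3`: the intersections of the basic sectors with the opposite
ones. -/
noncomputable def both : SectorFamily (Fin 3 × Fin 3) where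
  sector p := base.sector p.1 ∩ base.neg.sector p.2
  center p := base.center p.1 + base.neg.center p.2
  next p := (base.next p.1, base.neg.next p.2)
  isOpen p := (base.isOpen p.1).inter (base.neg.isOpen p.2)
  eq_of_mem h h' := Prod.ext (base.eq_of_mem h.1 h'.1) (base.neg.eq_of_mem h.2 h'.2)
  smul_mem r hr h := ⟨base.smul_mem r hr h.1, base.neg.smul_mem r hr h.2⟩
  segment_mem {p α} t h0 h1 h := by
    obtain ⟨i, j⟩ := p
    obtain ⟨⟨h2, h3⟩, h4, h5⟩ := h
    have hs : 0 < √3 / 2 := by positivity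
    rw [func_neg] at h4 h5
    -- For `i = j` the sector is empty and the hypotheses contradict each other; for the six pairs
    -- with `i ≠ j` the sum of the two centers satisfies all four inequalities.
    have key : (0 < func (i + 1) (baseCenter i + -baseCenter j) ∧
        func (i + 2) (baseCenter i + -baseCenter j) < 0) ∧
        0 < -func (j + 1) (baseCenter i + -baseCenter j) ∧
        -func (j + 2) (baseCenter i + -baseCenter j) < 0 := by
      simp only [func_add, func_neg, func_baseCenter]
      fin_cases i <;> fin_cases j
      all_goals
        dsimp at h2 h3 h4 h5
        first
        | exact absurd h2 (by linarith)
        | simp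
    refine ⟨⟨?_, ?_⟩, ?_, ?_⟩
    · rw [func_segment]; exact segment_pos h0 h1 h2 key.1.1
    · rw [func_segment]; exact segment_neg h0 h1 h3 key.1.2
    · rw [func_neg, func_segment, neg_add, ← mul_neg, ← mul_neg]
      exact segment_pos h0 h1 h4 key.2.1
    · rw [func_neg, func_segment, neg_add, ← mul_neg, ← mul_neg]
      exact segment_neg h0 h1 h5 key.2.2
  omega_mul_mem h := ⟨base.omega_mul_mem h.1, base.neg.omega_mul_mem h.2⟩
  center_next p := by rw [base.center_next, base.neg.center_next, mul_add]

theorem carrier_both : both.carrier = base.carrier ∩ base.neg.carrier := by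
  ext α
  exact ⟨fun ⟨p, h⟩ => ⟨⟨p.1, h.1⟩, ⟨p.2, h.2⟩⟩, fun ⟨⟨i, hi⟩, ⟨j, hj⟩⟩ => ⟨(i, j), hi, hj⟩⟩

theorem zero_notMem_carrier_base : (0 : ℂ) ∉ base.carrier := by
  rintro ⟨j, h, -⟩
  simp [func] at h

/-- The three real numbers `func k α` sum to zero. Unless all vanish, two of them have strictly
opposite signs, and their cyclic order decides whether `α` lies in a basic sector or in an opposite
one. If all vanish, then `α = 0`. -/
theorem carrier_base_union : base.carrier ∪ base.neg.carrier = {α | α ≠ 0} := by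
  ext α
  constructor
  · rintro (h | ⟨j, h⟩) rfl
    · exact zero_notMem_carrier_base h
    · exact zero_notMem_carrier_base ⟨j, by simpa [neg] using h⟩
  · intro hα
    have h0 := func_zero_add α
    have hb (k : Fin 3) (h : 0 < func (k + 1) α ∧ func (k + 2) α < 0) :
        α ∈ base.carrier ∪ base.neg.carrier := .inl ⟨k, h⟩
    have hn (k : Fin 3) (h : 0 < -func (k + 1) α ∧ -func (k + 2) α < 0) :
        α ∈ base.carrier ∪ base.neg.carrier := .inr ⟨k, by
      refine ⟨?_, ?_⟩ <;> rw [func_neg]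
      exacts [h.1, h.2]⟩
    have b0 : 0 < func 1 α ∧ func 2 α < 0 → _ := hb 0
    have b1 : 0 < func 2 α ∧ func 0 α < 0 → _ := hb 1
    have b2 : 0 < func 0 α ∧ func 1 α < 0 → _ := hb 2
    have n0 : 0 < -func 1 α ∧ -func 2 α < 0 → _ := hn 0
    have n1 : 0 < -func 2 α ∧ -func 0 α < 0 → _ := hn 1
    have n2 : 0 < -func 0 α ∧ -func 1 α < 0 → _ := hn 2
    by_contra hmem
    have z0 : func 0 α = 0 := by
      rcases lt_trichotomy (func 0 α) 0 with h | h | h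
      · by_cases h1 : 0 < func 1 α
        · exact absurd (n2 ⟨by linarith, by linarith⟩) hmem
        · exact absurd (b1 ⟨by linarith, h⟩) hmem
      · exact h
      · by_cases h1 : func 1 α < 0
        · exact absurd (b2 ⟨h, h1⟩) hmem
        · exact absurd (n1 ⟨by linarith, by linarith⟩) hmem
    have z1 : func 1 α = 0 := by
      rcases lt_trichotomy (func 1 α) 0 with h | h | h
      · exact absurd (n0 ⟨by linarith, by linarith⟩) hmem
      · exact h
      · exact absurd (b0 ⟨h, by linarith⟩) hmem
    have hi : α.im = 0 := by simpa [func] using z0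
    have hr : α.re = 0 := by
      simpa [func, omega, hi] using z1
    exact hα (Complex.ext hr hi)

end SectorFamily

end ThreeSphere

namespace ThreeSphere

open SingularChain

/-! ### Invariant chains on the sphere -/

namespace SectorFamily

variable {J J' : Type}

open Classical in
/-- The center of the sector containing a given number. -/
noncomputable def target (F : SectorFamily J) (α : ℂ) : ℂ :=
  if h : ∃ j, α ∈ F.sector j then F.center h.choose else 0

theorem target_eq (F : SectorFamily J) {j : J} {α : ℂ} (h : α ∈ F.sector j) :
    F.target α = F.center j := by
  have h' : ∃ j, α ∈ F.sector j := ⟨j, h⟩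
  rw [target, dif_pos h', F.eq_of_mem h'.choose_spec h]

theorem target_omega_mul (F : SectorFamily J) {α : ℂ} (h : α ∈ F.carrier) :
    F.target (omega * α) = omega * F.target α := by
  obtain ⟨j, hj⟩ := h
  rw [F.target_eq (F.omega_mul_mem hj), F.target_eq hj, F.center_next]

theorem segment_target_mem (F : SectorFamily J) {α : ℂ} (h : α ∈ F.carrier) {t : ℝ} (h0 : 0 ≤ t)
    (h1 : t ≤ 1) : (1 - t) * α + t * F.target α ∈ F.carrier := by
  obtain ⟨j, hj⟩ := h
  rw [F.target_eq hj]
  exact ⟨j, F.segment_mem t h0 h1 hj⟩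

theorem isLocallyConstant_target {T : Type*} [TopologicalSpace T] (F : SectorFamily J) {f : T → ℂ}
    (hf : Continuous f) (h : ∀ t, f t ∈ F.carrier) : IsLocallyConstant fun t => F.target (f t) := by
  rw [IsLocallyConstant.iff_eventually_eq]
  intro t
  obtain ⟨j, hj⟩ := h t
  filter_upwards [((F.isOpen j).preimage hf).mem_nhds hj] with s hs
  rw [F.target_eq hs, F.target_eq hj]

end SectorFamily

/-- The points of the sphere with coordinates in given sets. -/
def box (A B : Set ℂ) : Set ThreeSphere := onSphere {v | v 0 ∈ A ∧ v 1 ∈ B}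

theorem isOpen_box {A B : Set ℂ} (hA : IsOpen A) (hB : IsOpen B) : IsOpen (box A B) :=
  isOpen_onSphere ((hA.preimage (by fun_prop : Continuous fun v : Ambient => v 0)).inter
    (hB.preimage (by fun_prop : Continuous fun v : Ambient => v 1)))

theorem rot_apply (x : ThreeSphere) (i : Fin 2) :
    (rot x : Ambient) i = omega * (x : Ambient) i := by
  rw [coe_rot]; rfl

theorem norm_omega_smul (v : Ambient) : ‖omega • v‖ = ‖v‖ := by
  rw [norm_smul, Complex.norm_eq_one_of_pow_eq_one omega_cube (by norm_num), one_mul]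

/-- Each coordinate is moved along a straight line to the center of its sector. The end map is
locally constant because the sectors are open and disjoint, and equivariant because rotation
permutes the centers. The hypothesis on 0 keeps the path off the origin, so it can be projected to
the sphere. -/
theorem invariantlyBounds_box {J J' : Type} (F : SectorFamily J) (F' : SectorFamily J')
    (h0 : (0 : ℂ) ∉ F.carrier ∨ (0 : ℂ) ∉ F'.carrier) :
    InvariantlyBounds rot (box F.carrier F'.carrier) 1 := by
  let K : Set Ambient := {v | v 0 ∈ F.carrier ∧ v 1 ∈ F'.carrier}
  change InvariantlyBounds rot (onSphere K) 1
  have hK : IsCone K :=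
    { smul_mem := fun r hr v hv => by
        obtain ⟨⟨j, hj⟩, ⟨j', hj'⟩⟩ := hv
        exact ⟨⟨j, F.smul_mem r hr hj⟩, ⟨j', F'.smul_mem r hr hj'⟩⟩
      zero_notMem := fun h => h0.elim (fun h0 => h0 h.1) fun h0 => h0 h.2 }
  have hc0 : IsLocallyConstant fun x : onSphere K => F.target (((x : ThreeSphere) : Ambient) 0) :=
    F.isLocallyConstant_target (by fun_prop) fun x => x.2.1
  have hc1 : IsLocallyConstant fun x : onSphere K => F'.target (((x : ThreeSphere) : Ambient) 1) :=
    F'.isLocallyConstant_target (by fun_prop) fun x => x.2.2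
  have hc : IsLocallyConstant fun x : onSphere K =>
      (!₂[F.target (((x : ThreeSphere) : Ambient) 0),
        F'.target (((x : ThreeSphere) : Ambient) 1)] : Ambient) :=
    hc0.comp₂ hc1 fun a b => (!₂[a, b] : Ambient)
  let c : C(onSphere K, Ambient) := ⟨_, hc.continuous⟩
  have hcK (q) : lineTo c q ∈ K := by
    have e0 : lineTo c q 0 = (1 - (q.2 : ℝ)) * ((q.1 : ThreeSphere) : Ambient) 0 +
        (q.2 : ℝ) * F.target (((q.1 : ThreeSphere) : Ambient) 0) := by
      simp [lineTo, c]
    have e1 : lineTo c q 1 = (1 - (q.2 : ℝ)) * ((q.1 : ThreeSphere) : Ambient) 1 +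
        (q.2 : ℝ) * F'.target (((q.1 : ThreeSphere) : Ambient) 1) := by
      simp [lineTo, c]
    refine ⟨?_, ?_⟩
    · rw [e0]; exact F.segment_target_mem q.1.2.1 q.2.2.1 q.2.2.2
    · rw [e1]; exact F'.segment_target_mem q.1.2.2 q.2.2.1 q.2.2.2
  have hrot : Set.MapsTo rot (onSphere K) (onSphere K) := fun x hx => by
    refine ⟨?_, ?_⟩ <;> rw [rot_apply]
    exacts [F.omega_mul_mem_carrier hx.1, F'.omega_mul_mem_carrier hx.2]
  refine InvariantlyBounds.of_contraction hrot (normalize _ (lineTo_ne_zero hK hcK))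
    (fun q => hK.normalize_mem _ _ (hcK q)) (fun x => normalize_eq _ _ (by simp [lineTo])) ?_ ?_
  · refine IsLocallyConstant.desc _ Subtype.val ?_ Subtype.val_injective
    have h1 (x) : lineTo c (x, 1) = c x := by simp [lineTo]
    have h2 : Subtype.val ∘ (fun x => normalize _ (lineTo_ne_zero hK hcK) (x, 1)) =
        (fun v : Ambient => (‖v‖⁻¹ : ℝ) • v) ∘ c := by
      funext x
      simp only [Function.comp_apply, coe_normalize, h1]
    rw [h2]
    exact hc.comp _
  · intro x t
    have h1 : lineTo c (⟨rot x, hrot x.2⟩, t) = omega • lineTo c (x, t) := by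
      have hcr : c ⟨rot x, hrot x.2⟩ = omega • c x := by
        ext i
        fin_cases i
        · simp only [c, ContinuousMap.coe_mk]
          simp [rot_apply, F.target_omega_mul x.2.1]
        · simp only [c, ContinuousMap.coe_mk]
          simp [rot_apply, F'.target_omega_mul x.2.2]
      change (1 - (t : ℝ)) • (rot x : Ambient) + (t : ℝ) • c ⟨rot x, hrot x.2⟩ =
        omega • ((1 - (t : ℝ)) • ((x : ThreeSphere) : Ambient) + (t : ℝ) • c x)
      rw [hcr, coe_rot, smul_add, smul_comm omega, smul_comm omega]
    apply Subtype.ext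
    rw [coe_rot, coe_normalize, coe_normalize, h1, norm_omega_smul, smul_comm omega]

/-- A set of complex numbers stable under rotation. -/
def RotStable (A : Set ℂ) : Prop := ∀ α ∈ A, omega * α ∈ A

theorem rot_preimage_box {A B : Set ℂ} (hA : RotStable A) (hB : RotStable B) :
    rot ⁻¹' box A B = box A B := by
  have h {x : ThreeSphere} (hx : x ∈ box A B) : rot x ∈ box A B := by
    refine ⟨?_, ?_⟩ <;> rw [rot_apply]
    exacts [hA _ hx.1, hB _ hx.2]
  ext x
  exact ⟨fun hx => rot_rot_rot x ▸ h (h hx), h⟩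

/-- The punctured plane is covered by the basic sectors and their opposites, which meet in the six
small ones. Puncturing a coordinate thus costs one dimension. -/
theorem invariantlyBounds_ne_zero_left {B : Set ℂ} (hB : IsOpen B) (hrB : RotStable B) {k : ℕ}
    (h1 : InvariantlyBounds rot (box SectorFamily.base.carrier B) (k + 1))
    (h2 : InvariantlyBounds rot (box SectorFamily.base.neg.carrier B) (k + 1))
    (h3 : InvariantlyBounds rot (box SectorFamily.both.carrier B) k) :
    InvariantlyBounds rot (box {α | α ≠ 0} B) (k + 1) := by
  have e1 : box {α | α ≠ 0} B =
      box SectorFamily.base.carrier B ∪ box SectorFamily.base.neg.carrier B := by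
    rw [← SectorFamily.carrier_base_union]
    ext x
    exact or_and_right
  have e2 : box SectorFamily.both.carrier B =
      box SectorFamily.base.carrier B ∩ box SectorFamily.base.neg.carrier B := by
    rw [SectorFamily.carrier_both]
    ext x
    exact and_and_right
  rw [e1]
  exact .union (isOpen_box (SectorFamily.isOpen_carrier _) hB)
    (isOpen_box (SectorFamily.isOpen_carrier _) hB)
    (rot_preimage_box (fun _ => SectorFamily.omega_mul_mem_carrier _) hrB) h1 h2 (e2 ▸ h3)

theorem invariantlyBounds_ne_zero_right {A : Set ℂ} (hA : IsOpen A) (hrA : RotStable A) {k : ℕ}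
    (h1 : InvariantlyBounds rot (box A SectorFamily.base.carrier) (k + 1))
    (h2 : InvariantlyBounds rot (box A SectorFamily.base.neg.carrier) (k + 1))
    (h3 : InvariantlyBounds rot (box A SectorFamily.both.carrier) k) :
    InvariantlyBounds rot (box A {α | α ≠ 0}) (k + 1) := by
  have e1 : box A {α | α ≠ 0} =
      box A SectorFamily.base.carrier ∪ box A SectorFamily.base.neg.carrier := by
    rw [← SectorFamily.carrier_base_union]
    ext x
    exact and_or_left
  have e2 : box A SectorFamily.both.carrier =
      box A SectorFamily.base.carrier ∩ box A SectorFamily.base.neg.carrier := by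
    rw [SectorFamily.carrier_both]
    ext x
    exact and_and_left
  rw [e1]
  exact .union (isOpen_box hA (SectorFamily.isOpen_carrier _))
    (isOpen_box hA (SectorFamily.isOpen_carrier _))
    (rot_preimage_box hrA (fun _ => SectorFamily.omega_mul_mem_carrier _)) h1 h2 (e2 ▸ h3)

/-- The bound grows by one with each cover: 1 on products of sector families, 2 with one punctured
coordinate, 3 with both punctured, and 4 on the union of `{α ≠ 0}` and `{β ≠ 0}`, which is the whole
sphere. -/
theorem invariantlyBounds_univ : InvariantlyBounds rot Set.univ 4 := by
  have hne : IsOpen {α : ℂ | α ≠ 0} := isOpen_ne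
  have hrne : RotStable {α | α ≠ 0} := fun α hα =>
    mul_ne_zero (fun h => by simpa [h] using omega_cube) hα
  have hwhole : SectorFamily.whole.carrier = Set.univ :=
    Set.eq_univ_of_forall fun _ => ⟨(), trivial⟩
  have z0 := SectorFamily.zero_notMem_carrier_base
  have z1 : (0 : ℂ) ∉ SectorFamily.base.neg.carrier := fun ⟨j, h⟩ =>
    z0 ⟨j, by simpa [SectorFamily.neg] using h⟩
  have z2 : (0 : ℂ) ∉ SectorFamily.both.carrier := by
    rw [SectorFamily.carrier_both]
    exact fun h => z0 h.1
  have hU : InvariantlyBounds rot (box {α | α ≠ 0} Set.univ) 2 := by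
    rw [← hwhole]
    exact invariantlyBounds_ne_zero_left (SectorFamily.isOpen_carrier _)
      (fun _ => SectorFamily.omega_mul_mem_carrier _)
      ((invariantlyBounds_box _ _ (.inl z0)).mono one_le_two)
      ((invariantlyBounds_box _ _ (.inl z1)).mono one_le_two)
      (invariantlyBounds_box _ _ (.inl z2))
  have hV : InvariantlyBounds rot (box Set.univ {α | α ≠ 0}) 2 := by
    rw [← hwhole]
    exact invariantlyBounds_ne_zero_right (SectorFamily.isOpen_carrier _)
      (fun _ => SectorFamily.omega_mul_mem_carrier _)
      ((invariantlyBounds_box _ _ (.inr z0)).mono one_le_two)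
      ((invariantlyBounds_box _ _ (.inr z1)).mono one_le_two)
      (invariantlyBounds_box _ _ (.inr z2))
  have hstrip {J : Type} (F : SectorFamily J) (hF : (0 : ℂ) ∉ F.carrier) :
      InvariantlyBounds rot (box F.carrier {α | α ≠ 0}) 2 :=
    invariantlyBounds_ne_zero_right (SectorFamily.isOpen_carrier _)
      (fun _ => SectorFamily.omega_mul_mem_carrier _)
      ((invariantlyBounds_box _ _ (.inl hF)).mono one_le_two)
      ((invariantlyBounds_box _ _ (.inl hF)).mono one_le_two)
      (invariantlyBounds_box _ _ (.inl hF))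
  have hUV : InvariantlyBounds rot (box {α | α ≠ 0} {α | α ≠ 0}) 3 :=
    invariantlyBounds_ne_zero_left hne hrne ((hstrip _ z0).mono (by norm_num))
      ((hstrip _ z1).mono (by norm_num)) (hstrip _ z2)
  have e1 : box {α | α ≠ 0} Set.univ ∪ box Set.univ {α | α ≠ 0} = Set.univ := by
    refine Set.eq_univ_of_forall fun x => ?_
    by_contra h
    have h0 : (x : Ambient) 0 = 0 := by
      by_contra h0
      exact h (.inl ⟨h0, trivial⟩)
    have h1 : (x : Ambient) 1 = 0 := by
      by_contra h1
      exact h (.inr ⟨trivial, h1⟩)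
    have hx : (x : Ambient) = 0 := by
      ext i
      fin_cases i
      exacts [h0, h1]
    have := norm_coe x
    rw [hx, norm_zero] at this
    exact zero_ne_one this
  have e2 : box {α | α ≠ 0} Set.univ ∩ box Set.univ {α | α ≠ 0} =
      box {α | α ≠ 0} {α | α ≠ 0} := by
    ext x
    exact ⟨fun h => ⟨h.1.1, h.2.2⟩, fun h => ⟨⟨h.1, trivial⟩, ⟨trivial, h.2⟩⟩⟩
  rw [← e1]
  exact .union (isOpen_box hne isOpen_univ) (isOpen_box isOpen_univ hne)
    (rot_preimage_box hrne fun _ _ => trivial) (hU.mono (by norm_num)) (hV.mono (by norm_num))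
    (e2 ▸ hUV)

end ThreeSphere

namespace ThreeSphere

open SingularChain

/-! ### Quaternion multiplication -/

/-- The point of the sphere with given coordinates. -/
noncomputable def mk (a b : ℂ) (h : Complex.normSq a + Complex.normSq b = 1) : ThreeSphere :=
  ⟨!₂[a, b], by
    rw [mem_sphere_zero_iff_norm, EuclideanSpace.norm_eq]
    simp [← Complex.normSq_eq_norm_sq, h]⟩

theorem ext_coords {x y : ThreeSphere} (h0 : (x : Ambient) 0 = (y : Ambient) 0)
    (h1 : (x : Ambient) 1 = (y : Ambient) 1) : x = y := by
  apply Subtype.ext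
  ext i
  fin_cases i
  exacts [h0, h1]

theorem normSq_add (x : ThreeSphere) :
    Complex.normSq ((x : Ambient) 0) + Complex.normSq ((x : Ambient) 1) = 1 := by
  have h := norm_coe x
  rw [EuclideanSpace.norm_eq, Real.sqrt_eq_one, Fin.sum_univ_two] at h
  rw [Complex.normSq_eq_norm_sq, Complex.normSq_eq_norm_sq, h]

theorem mul_conj_add (x : ThreeSphere) :
    (x : Ambient) 0 * star ((x : Ambient) 0) + (x : Ambient) 1 * star ((x : Ambient) 1) = 1 := by
  have h := congrArg (fun r : ℝ => (r : ℂ)) (normSq_add x)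
  simpa [Complex.mul_conj] using h

/-- Multiplication of unit quaternions `α + β j`. -/
noncomputable def mul : C(ThreeSphere × ThreeSphere, ThreeSphere) where
  toFun p := mk
    ((p.1 : Ambient) 0 * (p.2 : Ambient) 0 - (p.1 : Ambient) 1 * star ((p.2 : Ambient) 1))
    ((p.1 : Ambient) 0 * (p.2 : Ambient) 1 + (p.1 : Ambient) 1 * star ((p.2 : Ambient) 0)) (by
      have h : (Complex.normSq ((p.1 : Ambient) 0) + Complex.normSq ((p.1 : Ambient) 1)) *
          (Complex.normSq ((p.2 : Ambient) 0) + Complex.normSq ((p.2 : Ambient) 1)) = 1 := by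
        rw [normSq_add, normSq_add, one_mul]
      refine Eq.trans ?_ h
      simp only [Complex.normSq_apply, Complex.sub_re, Complex.sub_im, Complex.add_re,
        Complex.add_im, Complex.mul_re, Complex.mul_im, Complex.star_def, Complex.conj_re,
        Complex.conj_im]
      ring)
  continuous_toFun := Continuous.subtype_mk (by fun_prop) _

theorem mul_zero_coord (x y : ThreeSphere) : (mul (x, y) : Ambient) 0 =
    (x : Ambient) 0 * (y : Ambient) 0 - (x : Ambient) 1 * star ((y : Ambient) 1) := rfl

theorem mul_one_coord (x y : ThreeSphere) : (mul (x, y) : Ambient) 1 =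
    (x : Ambient) 0 * (y : Ambient) 1 + (x : Ambient) 1 * star ((y : Ambient) 0) := rfl

/-- Inversion of unit quaternions. -/
noncomputable def inv : C(ThreeSphere, ThreeSphere) where
  toFun x := mk (star ((x : Ambient) 0)) (-(x : Ambient) 1) (by
    rw [Complex.star_def, Complex.normSq_conj, Complex.normSq_neg, normSq_add])
  continuous_toFun := Continuous.subtype_mk (by fun_prop) _

theorem inv_zero_coord (x : ThreeSphere) : (inv x : Ambient) 0 = star ((x : Ambient) 0) := rfl

theorem inv_one_coord (x : ThreeSphere) : (inv x : Ambient) 1 = -(x : Ambient) 1 := rfl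

/-- The unit quaternion `1`. -/
noncomputable def unit : ThreeSphere := mk 1 0 (by simp)

theorem mul_unit (x : ThreeSphere) : mul (x, unit) = x := by
  refine ext_coords ?_ ?_
  · rw [mul_zero_coord]; simp [unit, mk]
  · rw [mul_one_coord]; simp [unit, mk]

theorem unit_mul (x : ThreeSphere) : mul (unit, x) = x := by
  refine ext_coords ?_ ?_
  · rw [mul_zero_coord]; simp [unit, mk]
  · rw [mul_one_coord]; simp [unit, mk]

theorem mul_inv_mul (x y : ThreeSphere) : mul (x, mul (inv x, y)) = y := by
  have h := mul_conj_add x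
  refine ext_coords ?_ ?_
  · rw [mul_zero_coord, mul_zero_coord, mul_one_coord, inv_zero_coord, inv_one_coord, star_add,
      star_mul, star_mul, star_neg, star_star, star_star]
    linear_combination ((y : Ambient) 0) * h
  · rw [mul_one_coord, mul_zero_coord, mul_one_coord, inv_zero_coord, inv_one_coord, star_sub,
      star_mul, star_mul, star_neg, star_star, star_star]
    linear_combination ((y : Ambient) 1) * h

theorem star_omega_mul : star omega * omega = 1 := by
  rw [Complex.star_def, ← Complex.normSq_eq_conj_mul_self, Complex.normSq_eq_norm_sq,
    Complex.norm_eq_one_of_pow_eq_one omega_cube (by norm_num)]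
  simp

/-- The rotation is left multiplication by the unit quaternion `ω`, which cancels in `(ωx)⁻¹(ωy)`.
-/
theorem inv_rot_mul_rot (x y : ThreeSphere) : mul (inv (rot x), rot y) = mul (inv x, y) := by
  have h := star_omega_mul
  refine ext_coords ?_ ?_
  · simp only [mul_zero_coord, inv_zero_coord, inv_one_coord, rot_apply, star_mul]
    linear_combination (star ((x : Ambient) 0) * (y : Ambient) 0 +
      (x : Ambient) 1 * star ((y : Ambient) 1)) * h
  · simp only [mul_one_coord, inv_zero_coord, inv_one_coord, rot_apply, star_mul]
    linear_combination (star ((x : Ambient) 0) * (y : Ambient) 1 -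
      (x : Ambient) 1 * star ((y : Ambient) 0)) * h

/-! ### Homotopies of the sphere -/

instance : PathConnectedSpace ThreeSphere := by
  rw [← isPathConnected_iff_pathConnectedSpace]
  refine isPathConnected_sphere ?_ 0 zero_le_one
  have h : Module.finrank ℝ Ambient = 4 := by
    rw [finrank_real_of_complex, finrank_euclideanSpace_fin]
  rw [← Module.finrank_eq_rank, h]
  norm_num

theorem homotopic_const (x y : ThreeSphere) :
    (ContinuousMap.const ThreeSphere x).Homotopic (ContinuousMap.const ThreeSphere y) :=
  ContinuousMap.homotopic_const_iff.2 (PathConnectedSpace.joined x y)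

/-- The pointwise product of two maps. -/
noncomputable def pmul (a b : C(ThreeSphere, ThreeSphere)) : C(ThreeSphere, ThreeSphere) :=
  mul.comp (a.prodMk b)

theorem pmul_homotopic {a a' b b' : C(ThreeSphere, ThreeSphere)} (ha : a.Homotopic a')
    (hb : b.Homotopic b') : (pmul a b).Homotopic (pmul a' b') :=
  (ContinuousMap.Homotopic.refl mul).comp (ha.prodMk hb)

theorem pmul_const_homotopic (a : C(ThreeSphere, ThreeSphere)) (c : ThreeSphere) :
    (pmul a (ContinuousMap.const _ c)).Homotopic a := by
  have h := pmul_homotopic (.refl a) (homotopic_const c unit)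
  rwa [show pmul a (ContinuousMap.const _ unit) = a from
    ContinuousMap.ext fun x => mul_unit (a x)] at h

theorem const_pmul_homotopic (a : C(ThreeSphere, ThreeSphere)) (c : ThreeSphere) :
    (pmul (ContinuousMap.const _ c) a).Homotopic a := by
  have h := pmul_homotopic (homotopic_const c unit) (.refl a)
  rwa [show pmul (ContinuousMap.const _ unit) a = a from
    ContinuousMap.ext fun x => unit_mul (a x)] at h

/-- Left multiplication by `ω` deforms to the identity along a path from `ω` to 1 in the sphere. -/
theorem rot_homotopic : rot.Homotopic (ContinuousMap.id ThreeSphere) := by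
  have h := const_pmul_homotopic (ContinuousMap.id ThreeSphere) (rot unit)
  rwa [show pmul (ContinuousMap.const _ (rot unit)) (ContinuousMap.id ThreeSphere) = rot from
    ContinuousMap.ext fun x => ?_] at h
  change mul (rot unit, x) = rot x
  refine ext_coords ?_ ?_
  · rw [mul_zero_coord, rot_apply, rot_apply, rot_apply]; simp [unit, mk]
  · rw [mul_one_coord, rot_apply, rot_apply, rot_apply]; simp [unit, mk]

/-- Points are pushed towards the pole `p` with a weight that equals 1 on a cap larger than a
hemisphere. The caps for `s = 1` and `s = -1` cover the sphere. -/
theorem exists_collapse (s : ℝ) (hs : |s| = 1) :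
    ∃ (h : C(ThreeSphere, ThreeSphere)) (p : ThreeSphere),
      (ContinuousMap.id ThreeSphere).Homotopic h ∧
        ∀ x : ThreeSphere, -1 / 2 < s * coord 0 x → h x = p := by
  obtain ⟨p, hp⟩ := exists_coord 0 s hs
  have hss : s * s = 1 := by rw [← abs_mul_abs_self, hs, one_mul]
  -- The weight is 1 where `s * coord 0 x ≥ -1/2` and 0 where it is at most `-3/4`, in particular
  -- near the antipode of `p`.
  let w (x : ThreeSphere) : ℝ := max 0 (min 1 (4 * (s * coord 0 x) + 3))
  have hw : Continuous w := by
    have : Continuous fun x : ThreeSphere => coord 0 (x : Ambient) :=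
      (continuous_coord 0).comp continuous_subtype_val
    exact continuous_const.max (continuous_const.min
      ((continuous_const.mul (continuous_const.mul this)).add continuous_const))
  have hw0 (x) : 0 ≤ w x := le_max_left _ _
  have hw1 (x) : w x ≤ 1 := max_le zero_le_one (min_le_left _ _)
  let k : C(unitInterval × ThreeSphere, Ambient) :=
    ⟨fun q => (1 - (q.1 : ℝ) * w q.2) • (q.2 : Ambient) + ((q.1 : ℝ) * w q.2) • (p : Ambient),
      by fun_prop⟩
  have hk (q) : k q ≠ 0 := by
    intro h
    have h1 : (1 - (q.1 : ℝ) * w q.2) • (q.2 : Ambient) =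
      -(((q.1 : ℝ) * w q.2) • (p : Ambient)) := eq_neg_of_add_eq_zero_left h
    have hm0 : 0 ≤ (q.1 : ℝ) * w q.2 := mul_nonneg q.1.2.1 (hw0 _)
    have hm1 : (q.1 : ℝ) * w q.2 ≤ 1 := mul_le_one₀ q.1.2.2 (hw0 _) (hw1 _)
    have h2 := congrArg norm h1
    rw [norm_neg, norm_smul, norm_smul, norm_coe, norm_coe, Real.norm_of_nonneg hm0,
      Real.norm_of_nonneg (by linarith)] at h2
    have h3 := congrArg (coord 0) h
    change coord 0 ((1 - (q.1 : ℝ) * w q.2) • (q.2 : Ambient) +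
      ((q.1 : ℝ) * w q.2) • (p : Ambient)) = coord 0 0 at h3
    rw [coord_add, coord_smul, coord_smul, hp, if_pos rfl,
      show coord 0 (0 : Ambient) = 0 by simp [coord]] at h3
    -- A segment between unit vectors can meet the origin only at its midpoint and between
    -- antipodes; but at the antipode of `p` the weight is zero.
    have hm : (q.1 : ℝ) * w q.2 = 1 / 2 := by linarith
    rw [hm] at h3
    have h4 : s * coord 0 (q.2 : Ambient) = -1 := by linear_combination 2 * s * h3 - hss
    have h5 : w q.2 = 0 := by
      simp only [w, h4]
      norm_num
    rw [h5] at hm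
    norm_num at hm
  let H := normalize k hk
  refine ⟨H.comp ((ContinuousMap.const _ 1).prodMk (ContinuousMap.id _)), p, ⟨⟨H, fun x => ?_,
    fun x => rfl⟩⟩, fun x hx => ?_⟩
  · exact normalize_eq k hk (by simp [k])
  · refine normalize_eq k hk ?_
    have h1 : w x = 1 := by
      simp only [w]
      rw [min_eq_left (by linarith), max_eq_right zero_le_one]
    simp [k, h1]

/-! ### Additivity and divisibility -/

theorem push_congr {X Y : Type*} [TopologicalSpace X] [TopologicalSpace Y] {f f' : C(X, Y)}
    {W : Set X} (h : ∀ x ∈ W, f x = f' x) {n : ℕ} {c : Chain X n} (hc : c ∈ chainsIn W n) :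
    push f n c = push f' n c := by
  refine sub_eq_zero.1 (map_mem_of_supported (L := push f n - push f' n) (p := ⊥)
    (fun σ hσ => ?_) hc)
  rw [LinearMap.sub_apply, push_single, push_single,
    show f.comp σ = f'.comp σ from ContinuousMap.ext fun t => h _ (hσ t), sub_self]
  exact Submodule.zero_mem _

/-- The boundaries. -/
noncomputable abbrev boundaries (n : ℕ) : Submodule ℤ (Chain ThreeSphere n) :=
  LinearMap.range (bdry ThreeSphere n)

theorem push_sub_push_mem {f f' : C(ThreeSphere, ThreeSphere)} (h : f.Homotopic f') {n : ℕ}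
    {c : Chain ThreeSphere (n + 1)} (hc : bdry _ n c = 0) :
    push f (n + 1) c - push f' (n + 1) c ∈ boundaries (n + 1) := by
  obtain ⟨b, hb⟩ := exists_bdry_of_homotopic h.symm hc
  exact ⟨b, by rw [hb]; abel⟩

theorem push_mem_boundaries (f : C(ThreeSphere, ThreeSphere)) {n : ℕ} {c : Chain ThreeSphere n}
    (hc : c ∈ boundaries n) : push f n c ∈ boundaries n := by
  obtain ⟨b, rfl⟩ := hc
  exact ⟨push f (n + 1) b, bdry_push f b⟩

/-- Up to homotopy, `b` is constant on `U` and `a` is constant on `V`. With `A`, `B` and `C` the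
product with one or both factors frozen, `F = A` and `B = C` on `U`, while `F = B` and `A = C` on
`V`. Hence `F = A + B - C` on small chains, and the constant map `C` sends cycles to boundaries. -/
theorem push_pmul_mem (a b : C(ThreeSphere, ThreeSphere)) {n : ℕ}
    {z : Chain ThreeSphere (n + 1)} (hz : bdry _ n z = 0) :
    push (pmul a b) (n + 1) z - (push a (n + 1) z + push b (n + 1) z) ∈ boundaries (n + 1) := by
  obtain ⟨hU, p, hhU, hp⟩ := exists_collapse 1 (by simp)
  obtain ⟨hV, q, hhV, hq⟩ := exists_collapse (-1) (by simp)
  let U : Set ThreeSphere := {x | -1 / 2 < 1 * coord 0 x}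
  let V : Set ThreeSphere := {x | -1 / 2 < -1 * coord 0 x}
  have hc : Continuous fun x : ThreeSphere => coord 0 (x : Ambient) :=
    (continuous_coord 0).comp continuous_subtype_val
  have hUo : IsOpen U := isOpen_lt continuous_const (continuous_const.mul hc)
  have hVo : IsOpen V := isOpen_lt continuous_const (continuous_const.mul hc)
  have hUV (x : ThreeSphere) : x ∈ U ∪ V := by
    by_cases h : -1 / 2 < 1 * coord 0 (x : Ambient)
    · exact .inl h
    · refine .inr ?_
      change -1 / 2 < -1 * coord 0 (x : Ambient)
      linarith
  let F := pmul (a.comp hV) (b.comp hU)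
  let A := pmul (a.comp hV) (ContinuousMap.const _ (b p))
  let B := pmul (ContinuousMap.const _ (a q)) (b.comp hU)
  let C := ContinuousMap.const ThreeSphere (mul (a q, b p))
  have hcomp (a : C(ThreeSphere, ThreeSphere)) {h : C(ThreeSphere, ThreeSphere)}
      (hh : (ContinuousMap.id ThreeSphere).Homotopic h) : a.Homotopic (a.comp h) :=
    (ContinuousMap.Homotopic.refl a).comp hh
  have hF : (pmul a b).Homotopic F := pmul_homotopic (hcomp a hhV) (hcomp b hhU)
  have hA : A.Homotopic a := (pmul_const_homotopic _ _).trans (hcomp a hhV).symm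
  have hB : B.Homotopic b := (const_pmul_homotopic _ _).trans (hcomp b hhU).symm
  have hFA : ∀ x ∈ U, F x = A x := fun x hx => by
    change mul (a (hV x), b (hU x)) = mul (a (hV x), b p)
    rw [hp x hx]
  have hBC : ∀ x ∈ U, B x = C x := fun x hx => by
    change mul (a q, b (hU x)) = mul (a q, b p)
    rw [hp x hx]
  have hFB : ∀ x ∈ V, F x = B x := fun x hx => by
    change mul (a (hV x), b (hU x)) = mul (a q, b (hU x))
    rw [hq x hx]
  have hAC : ∀ x ∈ V, A x = C x := fun x hx => by
    change mul (a (hV x), b p) = mul (a q, b p)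
    rw [hq x hx]
  obtain ⟨e, -, -, he⟩ := exists_small_cycle hUo hVo (ContinuousMap.id _)
    ((Finsupp.mem_supported ℤ z).2 fun σ _ t => hUV (σ t)) (push_id z) hz
  obtain ⟨u, hu, v, hv, huv⟩ := Submodule.mem_sup.1 he
  have key : push F (n + 1) (u + v) =
      push A (n + 1) (u + v) + push B (n + 1) (u + v) - push C (n + 1) (u + v) := by
    simp only [map_add]
    rw [push_congr hFA hu, push_congr hFB hv, push_congr hBC hu, push_congr hAC hv]
    abel
  rw [huv] at key
  simp only [map_add] at key
  have hE (f : C(ThreeSphere, ThreeSphere)) :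
      push f (n + 1) (bdry _ (n + 1) e) ∈ boundaries (n + 1) := push_mem_boundaries f ⟨e, rfl⟩
  have hCz : push C (n + 1) z ∈ boundaries (n + 1) := by
    obtain ⟨w, -, hw⟩ := exists_bdry_of_push_const (X := ThreeSphere) (mul (a q, b p)) (c := z) hz
      (Set.mem_univ _)
    exact ⟨w, hw⟩
  have h1 := push_sub_push_mem hF hz
  have h2 := push_sub_push_mem hA hz
  have h3 := push_sub_push_mem hB hz
  have h4 := add_mem (add_mem h1 (add_mem h2 h3)) (sub_mem (sub_mem (add_mem (hE A) (hE B))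
    (add_mem (hE C) hCz)) (hE F))
  convert h4 using 1
  rw [eq_sub_of_add_eq key]
  abel

theorem rot_comp_rot_comp_rot_comp {n : ℕ} (σ : C(Splx n, ThreeSphere)) :
    rot.comp (rot.comp (rot.comp σ)) = σ :=
  ContinuousMap.ext fun t => rot_rot_rot (σ t)

theorem rot_comp_ne {n : ℕ} (σ : C(Splx (n + 1), ThreeSphere)) : rot.comp σ ≠ σ := fun h =>
  rot_ne _ (DFunLike.congr_fun h (verts (n + 1) 0))

theorem exists_push_norm_eq {n : ℕ} {x : Chain ThreeSphere (n + 1)}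
    (hx : push rot (n + 1) x = x) :
    ∃ e : Chain ThreeSphere (n + 1),
      x = e + push rot (n + 1) e + push rot (n + 1) (push rot (n + 1) e) :=
  exists_norm_eq (τ := fun σ : C(Splx (n + 1), ThreeSphere) => rot.comp σ)
    rot_comp_rot_comp_rot_comp rot_comp_ne hx

theorem exists_sub_push_eq {n : ℕ} {x : Chain ThreeSphere (n + 1)}
    (hx : x + push rot (n + 1) x + push rot (n + 1) (push rot (n + 1) x) = 0) :
    ∃ y : Chain ThreeSphere (n + 1), x = y - push rot (n + 1) y :=
  exists_sub_map_eq (τ := fun σ : C(Splx (n + 1), ThreeSphere) => rot.comp σ)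
    rot_comp_rot_comp_rot_comp rot_comp_ne hx

theorem push_rot_rot_rot {n : ℕ} (c : Chain ThreeSphere n) :
    push rot n (push rot n (push rot n c)) = c := by
  rw [push_push, push_push, ContinuousMap.comp_assoc,
    show rot.comp (rot.comp rot) = ContinuousMap.id _ from ContinuousMap.ext rot_rot_rot, push_id]

/-- A chain-level form of divisibility by the order of the group: `z` is made homologous to a norm,
and an invariant `f` sends the three terms of a norm to the same chain. -/
theorem exists_push_of_invariant (f : C(ThreeSphere, ThreeSphere)) (hf : f.comp rot = f)
    {n : ℕ} (hinv : InvariantlyBounds rot Set.univ (n + 1)) {z : Chain ThreeSphere (n + 1)} (hz : bdry _ n z = 0) :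
    ∃ w : Chain ThreeSphere (n + 1), bdry _ n w = 0 ∧ push f (n + 1) z - (3 : ℤ) • w ∈ boundaries (n + 1) := by
  obtain ⟨u, hu⟩ := exists_bdry_of_homotopic rot_homotopic.symm hz
  rw [push_id] at hu
  have hu' : bdry _ (n + 1) u = push rot (n + 1) z - z := by rw [hu]; abel
  -- The norm of `u` is an invariant cycle, since the norm of `ρz - z` telescopes to zero.
  obtain ⟨v, -, hgv, hv⟩ := hinv (n + 1) le_rfl
    (u + push rot (n + 2) u + push rot (n + 2) (push rot (n + 2) u)) (mem_chainsIn_univ _)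
    (by rw [map_add, map_add, push_rot_rot_rot]; abel)
    (by rw [map_add, map_add, bdry_push, bdry_push, bdry_push, hu', map_sub, map_sub,
      push_rot_rot_rot]; abel)
  obtain ⟨e, he⟩ : ∃ e, v = e + push rot (n + 3) e + push rot (n + 3) (push rot (n + 3) e) :=
    exists_push_norm_eq hgv
  -- Subtracting `∂e` kills the norm of `u`, so the difference lies in the image of `1 - ρ`.
  obtain ⟨y, hy⟩ : ∃ y, u - bdry _ (n + 2) e = y - push rot (n + 2) y := by
    refine exists_sub_push_eq ?_
    rw [he, map_add, map_add, bdry_push, bdry_push, bdry_push] at hv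
    rw [map_sub, map_sub, sub_add_sub_comm, sub_add_sub_comm]
    exact sub_eq_zero.2 hv.symm
  have hy' := congrArg (bdry _ (n + 1)) hy
  rw [map_sub, bdry_bdry, sub_zero, hu', map_sub, bdry_push] at hy'
  -- Taking boundaries of the previous identity gives `ρz - z = ∂y - ρ∂y`, which says that `z + ∂y`
  -- is invariant.
  obtain ⟨w, hw⟩ : ∃ w, z + bdry _ (n + 1) y = w + push rot (n + 1) w + push rot (n + 1) (push rot (n + 1) w) := by
    refine exists_push_norm_eq ?_
    rw [map_add, ← sub_eq_zero]
    rw [← sub_eq_zero] at hy'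
    rw [← hy']
    abel
  have hpf {m : ℕ} (c : Chain ThreeSphere m) : push f m (push rot m c) = push f m c := by
    rw [push_push, hf]
  have hfw := congrArg (push f (n + 1)) hw
  rw [map_add, map_add, map_add, hpf, hpf, hpf, ← bdry_push] at hfw
  have h3w : push f (n + 1) w + push f (n + 1) w + push f (n + 1) w = (3 : ℤ) • push f (n + 1) w := by module
  rw [h3w] at hfw
  refine ⟨push f (n + 1) w, ?_, -push f (n + 2) y, ?_⟩
  · have h := congrArg (bdry _ n) hfw
    rw [map_add, bdry_bdry, bdry_push, hz, map_zero, add_zero, map_smul] at h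
    -- The chain `w` need not be a cycle, but three times the boundary of its image vanishes and
    -- chains are torsion-free.
    exact (smul_eq_zero.1 h.symm).resolve_left (by norm_num)
  · rw [map_neg, ← hfw]
    abel

/-- On cycles, an equivariant map is homologous to multiplication by an integer congruent to one
modulo three, and this integer is unique. -/
theorem exists_degree (φ : C(ThreeSphere, ThreeSphere)) (hφ : ∀ x, φ (rot x) = rot (φ x)) :
    ∃ d : ℤ, (∀ c : Chain ThreeSphere 4, bdry _ 3 c = 0 → push φ 4 c - d • c ∈ boundaries 4) ∧
      (∀ d' : ℤ, (∀ c : Chain ThreeSphere 4, bdry _ 3 c = 0 →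
        push φ 4 c - d' • c ∈ boundaries 4) → d' = d) ∧ d ≡ 1 [ZMOD 3] := by
  obtain ⟨z, -, hz, hgen, hinf⟩ := infiniteCyclic_univ
  have hgen' (c : Chain ThreeSphere 4) (hc : bdry _ 3 c = 0) :
      ∃ k : ℤ, c - k • z ∈ boundaries 4 := by
    obtain ⟨k, b, -, rfl⟩ := hgen c (mem_chainsIn_univ c) hc
    exact ⟨k, b, by abel⟩
  let f := pmul inv φ
  have hf : f.comp rot = f := ContinuousMap.ext fun x => by
    change mul (inv (rot x), φ (rot x)) = mul (inv x, φ x)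
    rw [hφ, inv_rot_mul_rot]
  have hφf : pmul (ContinuousMap.id _) f = φ := ContinuousMap.ext fun x => mul_inv_mul x (φ x)
  obtain ⟨w, hw, hfw⟩ := exists_push_of_invariant f hf invariantlyBounds_univ hz
  obtain ⟨k, hk⟩ := hgen' w hw
  have h1 := push_pmul_mem (ContinuousMap.id _) f (n := 3) hz
  rw [hφf, push_id] at h1
  -- Additivity gives `φ z ~ z + f z`, and `f z ~ 3 w ~ 3k z`.
  have hd : push φ 4 z - (1 + 3 * k) • z ∈ boundaries 4 := by
    have h2 := add_mem (add_mem h1 hfw) (Submodule.smul_mem _ (3 : ℤ) hk)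
    convert h2 using 1
    module
  refine ⟨1 + 3 * k, fun c hc => ?_, fun d' hd' => ?_, ?_⟩
  · obtain ⟨m, hm⟩ := hgen' c hc
    have h2 := push_mem_boundaries φ hm
    rw [map_sub, map_smul] at h2
    have h3 := sub_mem (add_mem h2 (Submodule.smul_mem _ m hd))
      (Submodule.smul_mem _ (1 + 3 * k) hm)
    convert h3 using 1
    module
  -- Two degrees differ by an integer whose multiple of `z` bounds; `z` has infinite order in
  -- homology.
  · obtain ⟨b, hb⟩ := sub_mem hd (hd' z hz)
    have h2 := hinf (d' - (1 + 3 * k)) b (mem_chainsIn_univ b) (by rw [hb]; module)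
    linarith
  · exact (Int.modEq_iff_dvd.2 ⟨-k, by ring⟩)

end ThreeSphere

/-! ### Comparison of concrete chains with the categorical singular complex -/

open CategoryTheory Limits Simplicial Opposite

namespace SingularChain

variable {X Y : TopCat.{0}}

/-- The singular chain complex in Mathlib, with integral coefficients. -/
noncomputable abbrev complex (X : TopCat.{0}) : ChainComplex (ModuleCat.{0} ℤ) ℕ :=
  (TopCat.toSSet.obj X).chainComplex (ModuleCat.of ℤ ℤ)

/-- The map of singular chain complexes induced by a continuous map. -/
noncomputable abbrev complexMap (f : X ⟶ Y) : complex X ⟶ complex Y :=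
  SSet.chainComplexMap (TopCat.toSSet.map f) (ModuleCat.of ℤ ℤ)

/-- A continuous map on a standard simplex, as a simplex of the singular simplicial set. -/
noncomputable def simplex {n : ℕ} (σ : C(Splx (n + 1), X)) : (TopCat.toSSet.obj X) _⦋n⦌ :=
  (TopCat.toSSetObjEquiv X (op ⦋n⦌)).symm σ

theorem simplex_δ {n : ℕ} (i : Fin (n + 2)) (σ : C(Splx (n + 2), X)) :
    (TopCat.toSSet.obj X).δ i (simplex σ) = simplex (σ.comp (splxMap i.succAbove)) := rfl

theorem map_simplex {n : ℕ} (f : X ⟶ Y) (σ : C(Splx (n + 1), X)) :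
    (TopCat.toSSet.map f).app (op ⦋n⦌) (simplex σ) = simplex (f.hom.comp σ) := rfl

/-- The comparison of concrete singular chains with Mathlib's singular chain complex. -/
noncomputable def toComplex (X : TopCat.{0}) (n : ℕ) : Chain X (n + 1) →ₗ[ℤ] (complex X).X n :=
  Finsupp.linearCombination ℤ fun σ =>
    ((TopCat.toSSet.obj X).ιChainComplex (R := ModuleCat.of ℤ ℤ) (simplex σ)).hom (1 : ℤ)

theorem toComplex_single {n : ℕ} (σ : C(Splx (n + 1), X)) :
    toComplex X n (Finsupp.single σ 1) =
      ((TopCat.toSSet.obj X).ιChainComplex (R := ModuleCat.of ℤ ℤ) (simplex σ)).hom (1 : ℤ) :=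
  (Finsupp.linearCombination_single ..).trans
    (@one_smul ℤ _ _ ((complex X).X n).isModule.toMulAction _)

/-- The inverse of `toComplex`. -/
noncomputable def fromComplex (X : TopCat.{0}) (n : ℕ) :
    (complex X).X n ⟶ ModuleCat.of ℤ (Chain X (n + 1)) :=
  (SSet.isColimitChainComplexXCofan (TopCat.toSSet.obj X) (ModuleCat.of ℤ ℤ) n).desc
    (Cofan.mk _ fun x => ModuleCat.ofHom (LinearMap.toSpanSingleton ℤ (Chain X (n + 1))
      (Finsupp.single (TopCat.toSSetObjEquiv X (op ⦋n⦌) x) 1)))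

theorem ι_fromComplex {n : ℕ} (x : (TopCat.toSSet.obj X) _⦋n⦌) :
    (TopCat.toSSet.obj X).ιChainComplex (R := ModuleCat.of ℤ ℤ) x ≫ fromComplex X n =
      ModuleCat.ofHom (LinearMap.toSpanSingleton ℤ (Chain X (n + 1))
        (Finsupp.single (TopCat.toSSetObjEquiv X (op ⦋n⦌) x) 1)) :=
  (SSet.isColimitChainComplexXCofan (TopCat.toSSet.obj X) (ModuleCat.of ℤ ℤ) n).fac _ ⟨x⟩

theorem fromComplex_toComplex {n : ℕ} (c : Chain X (n + 1)) :
    (fromComplex X n).hom (toComplex X n c) = c := by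
  suffices h : (fromComplex X n).hom ∘ₗ toComplex X n = LinearMap.id from
    LinearMap.congr_fun h c
  refine Finsupp.lhom_ext' fun σ => LinearMap.ext_ring ?_
  have h := LinearMap.congr_fun (congrArg ModuleCat.Hom.hom (ι_fromComplex (simplex σ))) (1 : ℤ)
  simp only [LinearMap.comp_apply, Finsupp.lsingle_apply, toComplex_single,
    LinearMap.id_apply]
  refine h.trans ?_
  change (1 : ℤ) • Finsupp.single _ (1 : ℤ) = _
  rw [one_smul, simplex, Equiv.apply_symm_apply]

theorem toComplex_fromComplex {n : ℕ} (c : (complex X).X n) :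
    toComplex X n ((fromComplex X n).hom c) = c := by
  suffices h : fromComplex X n ≫ ModuleCat.ofHom (toComplex X n) = 𝟙 _ from
    LinearMap.congr_fun (congrArg ModuleCat.Hom.hom h) c
  refine SSet.chainComplex_hom_ext fun x => ?_
  rw [← Category.assoc, ι_fromComplex, Category.comp_id]
  refine ModuleCat.hom_ext (LinearMap.ext_ring ?_)
  change toComplex X n ((1 : ℤ) • Finsupp.single _ (1 : ℤ)) = _
  rw [one_smul, toComplex_single, simplex, Equiv.symm_apply_apply]

theorem d_toComplex {n : ℕ} (c : Chain X (n + 2)) :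
    ((complex X).d (n + 1) n).hom (toComplex X (n + 1) c) = toComplex X n (bdry X (n + 1) c) := by
  suffices h : ((complex X).d (n + 1) n).hom ∘ₗ toComplex X (n + 1) =
      toComplex X n ∘ₗ bdry X (n + 1) from LinearMap.congr_fun h c
  refine Finsupp.lhom_ext' fun σ => LinearMap.ext_ring ?_
  have h := LinearMap.congr_fun (congrArg ModuleCat.Hom.hom
    (SSet.ιChainComplex_d (TopCat.toSSet.obj X) (R := ModuleCat.of ℤ ℤ) (simplex σ))) (1 : ℤ)
  simp only [LinearMap.comp_apply, Finsupp.lsingle_apply, toComplex_single, one_smul, bdry_single,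
    map_sum]
  refine h.trans ?_
  rw [ModuleCat.hom_sum, LinearMap.sum_apply]
  refine Finset.sum_congr rfl fun i _ => ?_
  rw [ModuleCat.hom_zsmul]
  refine Eq.trans ?_ (map_zsmul (toComplex X n) _ _).symm
  rw [toComplex_single, ← simplex_δ]
  rfl

theorem complexMap_toComplex (f : X ⟶ Y) {n : ℕ} (c : Chain X (n + 1)) :
    ((complexMap f).f n).hom (toComplex X n c) = toComplex Y n (push f.hom (n + 1) c) := by
  suffices h : ((complexMap f).f n).hom ∘ₗ toComplex X n =
      toComplex Y n ∘ₗ push f.hom (n + 1) from LinearMap.congr_fun h c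
  refine Finsupp.lhom_ext' fun σ => LinearMap.ext_ring ?_
  have h := LinearMap.congr_fun (congrArg ModuleCat.Hom.hom
    (SSet.ι_chainComplexMap_f _ _ (TopCat.toSSet.map f) (ModuleCat.of ℤ ℤ) (simplex σ))) (1 : ℤ)
  simp only [LinearMap.comp_apply, Finsupp.lsingle_apply, toComplex_single, push_single]
  refine h.trans ?_
  rw [map_simplex]

end SingularChain

/-! ### Elements of the homology of a complex of modules -/

open CategoryTheory Limits

namespace HomologicalComplex

variable {ι : Type*} {c : ComplexShape ι} (K : HomologicalComplex (ModuleCat.{0} ℤ) c)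

theorem exists_homologyπ_eq {i : ι} (h : K.homology i) : ∃ z, (K.homologyπ i).hom z = h :=
  (ModuleCat.epi_iff_surjective _).1 inferInstance h

theorem exists_iCycles_eq {i j : ι} (hj : c.next i = j) {x : K.X i} (hx : (K.d i j).hom x = 0) :
    ∃ z, (K.iCycles i).hom z = x := by
  subst hj
  exact ⟨(K.sc i).moduleCatCyclesIso.inv.hom ⟨x, hx⟩,
    (K.sc i).moduleCatCyclesIso_inv_iCycles_apply ⟨x, hx⟩⟩

theorem d_iCycles_apply {i : ι} (j : ι) (z : K.cycles i) :
    (K.d i j).hom ((K.iCycles i).hom z) = 0 :=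
  LinearMap.congr_fun (congrArg ModuleCat.Hom.hom (K.iCycles_d i j)) z

/-- Homology embeds into opcycles, where the class of a cycle is the class of the underlying chain
modulo boundaries. -/
theorem homologyπ_eq_zero_iff {i j : ι} (hj : c.prev i = j) (z : K.cycles i) :
    (K.homologyπ i).hom z = 0 ↔ (K.iCycles i).hom z ∈ LinearMap.range (K.d j i).hom := by
  subst hj
  refine Iff.trans ?_ ((K.sc i).moduleCat_pOpcycles_eq_zero_iff ((K.iCycles i).hom z))
  rw [← map_eq_zero_iff (K.homologyι i).hom ((ModuleCat.mono_iff_injective _).1 inferInstance)]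
  have h := LinearMap.congr_fun (congrArg ModuleCat.Hom.hom (K.homology_π_ι i)) z
  exact Eq.congr_left h

end HomologicalComplex

/-! ### The degree in terms of singular cycles, and the conclusion -/

open SingularChain ThreeSphere

theorem singularH3_map_homologyπ {X Y : TopCat.{0}} (f : X ⟶ Y) (z : (complex X).cycles 3) :
    singularH3.map f (((complex X).homologyπ 3).hom z) =
      ((complex Y).homologyπ 3).hom ((HomologicalComplex.cyclesMap (complexMap f) 3).hom z) :=
  LinearMap.congr_fun (congrArg ModuleCat.Hom.hom
    (HomologicalComplex.homologyπ_naturality (complexMap f) 3)) z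

theorem toComplex_mem_range_d {X : TopCat.{0}} {n : ℕ} (c : Chain X (n + 1)) :
    toComplex X n c ∈ LinearMap.range ((complex X).d (n + 1) n).hom ↔
      c ∈ LinearMap.range (bdry X (n + 1)) := by
  constructor
  · rintro ⟨b, hb⟩
    refine ⟨(fromComplex X (n + 1)).hom b, ?_⟩
    rw [← fromComplex_toComplex (bdry X (n + 1) _), ← d_toComplex, toComplex_fromComplex, hb,
      fromComplex_toComplex]
  · rintro ⟨b, rfl⟩
    exact ⟨_, d_toComplex b⟩

/-- The mapping degree, read off from singular cycles. -/
theorem isMappingDegree_iff (φ : C(ThreeSphere, ThreeSphere)) (d : ℤ) :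
    IsMappingDegree φ d ↔ ∀ c : Chain ThreeSphere 4, bdry _ 3 c = 0 →
      push φ 4 c - d • c ∈ boundaries 4 := by
  let X := TopCat.of ThreeSphere
  let f : X ⟶ X := TopCat.ofHom φ
  -- It suffices to compare one homology class with one concrete cycle representing it; the two
  -- directions of the equivalence differ only in which of the two is given.
  have key (z : (complex X).cycles 3) (c : Chain X 4)
      (hzc : ((complex X).iCycles 3).hom z = toComplex X 3 c) :
      singularH3.map f (((complex X).homologyπ 3).hom z) = d • ((complex X).homologyπ 3).hom z ↔
        push φ 4 c - d • c ∈ boundaries 4 := by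
    refine (Eq.congr_left (singularH3_map_homologyπ f z)).trans ?_
    change (((complex X).homologyπ 3).hom
      ((HomologicalComplex.cyclesMap (complexMap f) 3).hom z) : (complex X).homology 3) =
        d • ((complex X).homologyπ 3).hom z ↔ _
    rw [← sub_eq_zero]
    have h := LinearMap.congr_fun (congrArg ModuleCat.Hom.hom
      (HomologicalComplex.cyclesMap_i (complexMap f) 3)) z
    have h' : ((complex X).iCycles 3).hom
        ((HomologicalComplex.cyclesMap (complexMap f) 3).hom z - d • z) =
        toComplex X 3 (push φ 4 c - d • c) := by
      rw [map_sub, map_zsmul, map_sub]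
      refine congrArg₂ (· - ·) (h.trans ?_) ?_
      · change ((complexMap f).f 3).hom (((complex X).iCycles 3).hom z) = _
        rw [hzc, complexMap_toComplex]
        rfl
      · rw [hzc]
        exact (map_zsmul (toComplex X 3) d c).symm
    have h'' := (complex X).homologyπ_eq_zero_iff (ChainComplex.prev ℕ 3)
      ((HomologicalComplex.cyclesMap (complexMap f) 3).hom z - d • z)
    rw [h', toComplex_mem_range_d, map_sub, map_zsmul] at h''
    exact h''
  constructor
  · intro h c hc
    obtain ⟨z, hz⟩ := (complex X).exists_iCycles_eq (i := 3) (j := 2) (x := toComplex X 3 c)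
      (ChainComplex.next_nat_succ 2) (by
        refine (d_toComplex (X := X) c).trans ?_
        exact (congrArg (toComplex X 2) hc).trans (map_zero _))
    exact (key z c hz).1 (h _)
  · intro h a
    obtain ⟨z, rfl⟩ := (complex X).exists_homologyπ_eq (i := 3) a
    have hz : ((complex X).iCycles 3).hom z =
        toComplex X 3 ((fromComplex X 3).hom (((complex X).iCycles 3).hom z)) :=
      (toComplex_fromComplex _).symm
    refine (key z _ hz).2 (h _ ?_)
    have h0 := (complex X).d_iCycles_apply 2 z
    rw [hz] at h0
    have h1 := (d_toComplex (X := X) (n := 2) _).symm.trans h0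
    have h2 := congrArg (fromComplex X 2).hom h1
    rwa [fromComplex_toComplex, map_zero] at h2

theorem mainTheorem12 (φ : C(ThreeSphere, ThreeSphere))
    (hφ : ∀ (ζ : rootsOfUnity 3 ℂ) (x : ThreeSphere), φ (ζ • x) = ζ • φ x) :
    ∃ d : ℤ, IsMappingDegree φ d ∧ (∀ d' : ℤ, IsMappingDegree φ d' → d' = d) ∧
      d ≡ 1 [ZMOD 3] := by
  -- Equivariance is needed only for the generator of `μ₃`.
  obtain ⟨d, hd, huniq, hmod⟩ := exists_degree φ (hφ zeta)
  exact ⟨d, (isMappingDegree_iff φ d).2 hd,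
    fun d' hd' => huniq d' ((isMappingDegree_iff φ d').1 hd'), hmod⟩
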